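/- **Conventions.** A finite presentation $G=\langle e_1,\dots,e_d\mid r_1,\dots,r_s\rangle$ of a group $G$ is an isomorphism $G\cong F/R$, where $F$ is the free group on $e_1,\dots,e_d$ and $R$ is the normal closure of $r_1,\dots,r_s\in F$. For $w\in R$ let $\delta_G^{\mathrm{cent}}(w)$ be the minimal $m\ge 0$ such that $w\in \prod_{i=1}^m g_i^{-1}r_{a_i}^{\pm1}g_i\,[R,F]$ for some $g_i\in F$, some indices $a_i$ and some signs. The centralized isoperimetric function of the presentation is $$\delta_G^{\mathrm{cent}}(n)=\max\{\delta_G^{\mathrm{cent}}(w) : w\in R,\ |w|\le n\},$$ where $|w|$ is the word length in $F$. For functions of $n\in\mathbb N$ with nonnegative values, $f=\Omega(g)$ means that there is a constant $m>0$ with $m\,g(n)\le f(n)$ for all large $n$, and $f=\Theta(g)$ means that there are constants $m,M>0$ with $m\,g(n)\le f(n)\le M g(n)$ for all large $n$. For a group $H$ let $H^{(1)}=H$ and $H^{(j+1)}=[H,H^{(j)}]$. A subgroup $B$ of $H$ has degree of distortion $k$ in $H$ if $k\ge1$ is the largest integer such that $H^{(k)}$ contains an element of $B$ of infinite order. **Proposition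 3.3.** Let $G$ be a finitely generated nilpotent group, and let $\delta_G^{\mathrm{cent}}$ be the centralized isoperimetric function of any finite presentation of $G$. 1. If $A$ is a finitely generated abelian group, $0\to A\to H\to G\to 1$ is a central extension, and $A$ has degree of distortion $k\ge 2$ in $H$, then $\delta_G^{\mathrm{cent}}(n)=\Omega(n^k)$. 2. If $\kappa$ is a real number with $\delta_G^{\mathrm{cent}}(n)=\Theta(n^{\kappa})$, then $\kappa$ is a positive integer and there is a central extension $0\to\mathbb Z\to H\to G\to 1$ in which $\mathbb Z$ has degree of distortion exactly $\kappa$. -/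

import Mathlib

open Filter Asymptotics

namespace CentExt

section Presentation

variable {d s : ℕ} (r : Fin s → FreeGroup (Fin d))

/-- The normal closure `R` of the relators `r₁, …, r_s` in the free group `F` on `d` generators. -/
def relSubgroup : Subgroup (FreeGroup (Fin d)) :=
  Subgroup.normalClosure (Set.range r)

/-- `x = g⁻¹ rᵢ^{±1} g` for some `g ∈ F` and some relator `rᵢ`. -/
def IsRelConj (x : FreeGroup (Fin d)) : Prop :=
  ∃ (g : FreeGroup (Fin d)) (i : Fin s), x = g⁻¹ * r i * g ∨ x = g⁻¹ * (r i)⁻¹ * g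

/-- `w` lies in the coset `x₁ ⋯ x_m [R, F]` for some `m` conjugates `x₁, …, x_m` of relators and
inverses of relators. -/
def HasCentDecomp (w : FreeGroup (Fin d)) (m : ℕ) : Prop :=
  ∃ L : List (FreeGroup (Fin d)), L.length = m ∧ (∀ x ∈ L, IsRelConj r x) ∧
    L.prod⁻¹ * w ∈ ⁅relSubgroup r, (⊤ : Subgroup (FreeGroup (Fin d)))⁆

/-- The centralized area of a word `w ∈ R`: the minimal number of factors in a decomposition of `w`
modulo `[R, F]` as a product of conjugates of relators and their inverses. -/
noncomputable def centArea (w : FreeGroup (Fin d)) : ℕ :=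
  sInf {m | HasCentDecomp r w m}

/-- The centralized isoperimetric function of the presentation: the maximal centralized area of an
element of `R` of word length at most `n` (see `isGreatest_centDehn`). -/
noncomputable def centDehn (n : ℕ) : ℕ :=
  sSup {m | ∃ w ∈ relSubgroup r, w.norm ≤ n ∧ centArea r w = m}

/-- Every element of `R` has a decomposition, so the minimum in `centArea` is attained. -/
theorem hasCentDecomp_centArea {w : FreeGroup (Fin d)} (hw : w ∈ relSubgroup r) :
    HasCentDecomp r w (centArea r w) := by
  have key : ∃ L : List (FreeGroup (Fin d)), (∀ x ∈ L, IsRelConj r x) ∧ L.prod = w := by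
    have h : w ∈ (Subgroup.closure (Group.conjugatesOfSet (Set.range r))).toSubmonoid := hw
    rw [Subgroup.closure_toSubmonoid] at h
    obtain ⟨L, hL, rfl⟩ := Submonoid.exists_list_of_mem_closure h
    refine ⟨L, fun x hx => ?_, rfl⟩
    rcases hL x hx with h | h
    · obtain ⟨_, ⟨i, rfl⟩, hc⟩ := Group.mem_conjugatesOfSet_iff.1 h
      obtain ⟨c, rfl⟩ := isConj_iff.1 hc
      exact ⟨c⁻¹, i, Or.inl (by simp)⟩
    · obtain ⟨_, ⟨i, rfl⟩, hc⟩ := Group.mem_conjugatesOfSet_iff.1 h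
      obtain ⟨c, hc⟩ := isConj_iff.1 hc
      refine ⟨c⁻¹, i, Or.inr ?_⟩
      rw [← inv_inv x, ← hc]
      group
  obtain ⟨L, hL, hw'⟩ := key
  exact Nat.sInf_mem (s := {m | HasCentDecomp r w m})
    ⟨L.length, L, rfl, hL, by rw [hw', inv_mul_cancel]; exact one_mem _⟩

/-- The maximum in the definition of `centDehn` is over a finite nonempty set and is attained. -/
theorem isGreatest_centDehn (n : ℕ) :
    IsGreatest {m | ∃ w ∈ relSubgroup r, w.norm ≤ n ∧ centArea r w = m} (centDehn r n) := by
  have hball : {w : FreeGroup (Fin d) | w.norm ≤ n}.Finite := by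
    refine Set.Finite.of_finite_image (f := FreeGroup.toWord) ?_
      FreeGroup.toWord_injective.injOn
    refine (List.finite_length_le (Fin d × Bool) n).subset ?_
    rintro _ ⟨w, hw, rfl⟩
    exact hw
  have hfin : {m | ∃ w ∈ relSubgroup r, w.norm ≤ n ∧ centArea r w = m}.Finite := by
    refine (hball.image (centArea r)).subset ?_
    rintro m ⟨w, -, hw, rfl⟩
    exact ⟨w, hw, rfl⟩
  have hne : {m | ∃ w ∈ relSubgroup r, w.norm ≤ n ∧ centArea r w = m}.Nonempty :=
    ⟨_, 1, one_mem _, by simp, rfl⟩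
  exact ⟨Nat.sSup_mem hne hfin.bddAbove, fun m hm => le_csSup hfin.bddAbove hm⟩

end Presentation

/-- The degree of distortion of a subgroup `B` of `H` is `k`: `k ≥ 1` is the largest index for which
the `k`-th term of the lower central series `H^(1) = H`, `H^(j+1) = [H^(j), H]` contains an element
of `B` of infinite order. -/
def IsDistortionDegree {H : Type*} [Group H] (B : Subgroup H) (k : ℕ) : Prop :=
  IsGreatest {j : ℕ | 1 ≤ j ∧
    ∃ b ∈ B, ¬ IsOfFinOrder b ∧ b ∈ (⊤ : Subgroup H).lowerCentralSeries (j - 1)} k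

/-- A group extension `1 → A → H → G → 1` is central: the image of `A` lies in the center of `H`. -/
def IsCentralExt {A H G : Type*} [Group A] [Group H] [Group G] (S : GroupExtension A H G) : Prop :=
  S.inl.range ≤ Subgroup.center H

end CentExt

/-! Write `G = F/R`. The centralized area of `w` is the word length of its class in `R/[R,F]`, a
finitely generated abelian group generated by the relators. Up to constants and torsion it is
therefore read off from functions `χ` that restrict to homomorphisms `R → ℤ` killing `[R,F]`. As `G`
is nilpotent, so is `F/[R,F]`, and the question is how strongly `R/[R,F]` is distorted in it. If `i`
is the largest index for which `R ∩ lcs i` has an element of infinite order modulo `[R,F]`, the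
growth is exactly `n^(i+1)`.

Lower bound (`isBigO_centDehn`): for such an element `b`, the power `b^(n^(i+1))` is represented
modulo `[R,F]` by a word of length O(n), while some `χ` forces its area to be at least a constant
times `n^(i+1)`. Upper bound (`centDehn_isBigO`): an element of `R` of length `n` is peeled along
the filtration `R ∩ lcs j`. Its coordinates at level `j` are O(n^(j+1)), and past level `i` only
torsion is left.

The estimates rest on the Magnus expansion. `MuBound` asks that the degree `j` part have norm at
most `n^j`, which behaves like a length under products. The Dynkin–Specht–Wever identity recovers
functionals on `lcs i` modulo `lcs (i+1)` from the part of degree `i+1`, which bounds coordinates;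
`exists_short_of_muBound` converts such bounds back into short words.

For a central extension `H` of `G`, a lift `F → H` kills `[R,F]` and covers the lower central series
of `H` from its second term on, so distorted central elements come from `R`. Conversely, the kernel
`N` of a `χ` on `R` with `χ b ≠ 0` gives the extension `F/N` of `G` by `ℤ`. Growth of type `n^κ`
excludes `R = [R,F]`, and `relSubgroup_le_relCommutator` shows that `R/[R,F]` cannot be a nontrivial
torsion group. -/

open scoped commutatorElement

/-- The lower central series of a group, indexed from `0`: `lcs Γ 0 = ⊤`. -/
abbrev lcs (Γ : Type*) [Group Γ] (m : ℕ) : Subgroup Γ := (⊤ : Subgroup Γ).lowerCentralSeries m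

/-! ### Commutator calculus and functionals on the lower central quotients -/

section LowerCentralSeries

variable {Γ : Type*} [Group Γ]

theorem commutator_mem_lcs_succ {m : ℕ} {u : Γ} (hu : u ∈ lcs Γ m) (x : Γ) :
    ⁅u, x⁆ ∈ lcs Γ (m + 1) :=
  Subgroup.commutator_mem_commutator hu (Subgroup.mem_top x)

theorem commutator_mem_lcs_succ' {m : ℕ} {u : Γ} (hu : u ∈ lcs Γ m) (x : Γ) :
    ⁅x, u⁆ ∈ lcs Γ (m + 1) := by
  rw [← commutatorElement_inv]
  exact inv_mem (commutator_mem_lcs_succ hu x)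

theorem lcs_succ_le (m : ℕ) : lcs Γ (m + 1) ≤ lcs Γ m :=
  Subgroup.lowerCentralSeries_antitone _ (Nat.le_succ m)

/-- The three subgroups lemma, applied in the quotient by `N`. -/
theorem Subgroup.commutator_commutator_le_of_rotate {N A B C : Subgroup Γ} [N.Normal]
    (h₁ : ⁅⁅B, C⁆, A⁆ ≤ N) (h₂ : ⁅⁅C, A⁆, B⁆ ≤ N) : ⁅⁅A, B⁆, C⁆ ≤ N := by
  have key : ∀ X Y Z : Subgroup Γ, ⁅⁅X, Y⁆, Z⁆ ≤ N ↔
      ⁅⁅X.map (QuotientGroup.mk' N), Y.map (QuotientGroup.mk' N)⁆,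
        Z.map (QuotientGroup.mk' N)⁆ = ⊥ := by
    intro X Y Z
    rw [← Subgroup.map_commutator, ← Subgroup.map_commutator, Subgroup.map_eq_bot_iff,
      QuotientGroup.ker_mk']
  rw [key] at *
  exact Subgroup.commutator_commutator_eq_bot_of_rotate h₁ h₂

theorem commutator_lcs_lcs_le (p q : ℕ) : ⁅lcs Γ p, lcs Γ q⁆ ≤ lcs Γ (p + q + 1) := by
  induction q generalizing p with
  | zero => exact le_rfl
  | succ q ih =>
    rw [Subgroup.commutator_comm]
    refine Subgroup.commutator_commutator_le_of_rotate ?_ ?_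
    · rw [Subgroup.commutator_comm ⊤]
      exact (ih (p + 1)).trans (Subgroup.lowerCentralSeries_antitone _ (by omega))
    · exact (Subgroup.commutator_mono (ih p) le_rfl)

theorem commutator_mem_lcs {p q : ℕ} {u v : Γ} (hu : u ∈ lcs Γ p) (hv : v ∈ lcs Γ q) :
    ⁅u, v⁆ ∈ lcs Γ (p + q + 1) :=
  commutator_lcs_lcs_le p q (Subgroup.commutator_mem_commutator hu hv)

/-- The integer-valued function `χ` restricts to a homomorphism on the `m`-th term of the lower
central series that vanishes on the next term. -/
structure LinOn (m : ℕ) (χ : Γ → ℤ) : Prop where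
  map_mul : ∀ u ∈ lcs Γ m, ∀ v ∈ lcs Γ m, χ (u * v) = χ u + χ v
  map_succ : ∀ u ∈ lcs Γ (m + 1), χ u = 0

namespace LinOn

variable {m p q r : ℕ} {χ χ' : Γ → ℤ}

theorem map_one (h : LinOn m χ) : χ 1 = 0 := h.map_succ 1 (one_mem _)

theorem map_inv (h : LinOn m χ) {u : Γ} (hu : u ∈ lcs Γ m) : χ u⁻¹ = -χ u := by
  have := h.map_mul u hu u⁻¹ (inv_mem hu)
  rw [mul_inv_cancel, h.map_one] at this
  omega

theorem map_conj (h : LinOn m χ) {u : Γ} (hu : u ∈ lcs Γ m) (g : Γ) : χ (g * u * g⁻¹) = χ u := by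
  have h1 : g * u * g⁻¹ = ⁅g, u⁆ * u := by simp [commutatorElement_def]
  have h2 := commutator_mem_lcs_succ' hu g
  rw [h1, h.map_mul _ (lcs_succ_le m h2) _ hu, h.map_succ _ h2, zero_add]

theorem map_commutator_swap (h : LinOn (p + q + 1) χ) {u v : Γ} (hu : u ∈ lcs Γ p)
    (hv : v ∈ lcs Γ q) : χ ⁅v, u⁆ = -χ ⁅u, v⁆ := by
  rw [← commutatorElement_inv, h.map_inv (commutator_mem_lcs hu hv)]

theorem commutator_left (h : LinOn (p + q + 1) χ) {y : Γ} (hy : y ∈ lcs Γ q) :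
    LinOn p (fun u : Γ => χ ⁅u, y⁆) where
  map_mul u hu v hv := by
    rw [commutatorElement_mul_left_eq_conj_mul, h.map_mul, h.map_conj (commutator_mem_lcs hv hy),
      add_comm]
    · exact (inferInstance : (lcs Γ (p + q + 1)).Normal).conj_mem _ (commutator_mem_lcs hv hy) _
    · exact commutator_mem_lcs hu hy
  map_succ u hu := h.map_succ _ (by
    have := commutator_mem_lcs hu hy
    rwa [show p + 1 + q + 1 = p + q + 1 + 1 by omega] at this)

theorem commutator_right (h : LinOn (p + q + 1) χ) {y : Γ} (hy : y ∈ lcs Γ q) :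
    LinOn p (fun u : Γ => χ ⁅y, u⁆) where
  map_mul u hu v hv := by
    have h' := h.commutator_left hy
    rw [h.map_commutator_swap hu hy, h.map_commutator_swap hv hy,
      h.map_commutator_swap (mul_mem hu hv) hy, h'.map_mul u hu v hv]
    ring
  map_succ u hu := by
    have h' := h.commutator_left hy
    rw [h.map_commutator_swap (lcs_succ_le p hu) hy, h'.map_succ u hu, neg_zero]

theorem map_commutator_conj (h : LinOn (p + q + 1) χ) {u v : Γ} (hu : u ∈ lcs Γ p)
    (hv : v ∈ lcs Γ q) (g : Γ) : χ ⁅u, g * v * g⁻¹⁆ = χ ⁅u, v⁆ :=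
  (show LinOn (q + p + 1) χ by rwa [add_comm q p]).commutator_right hu |>.map_conj hv g

/-- The Hall–Witt identity; its conjugations change the entries only by deeper commutators, which
`χ` does not see. -/
theorem jacobi (h : LinOn (p + q + r + 2) χ) {a b c : Γ} (ha : a ∈ lcs Γ p) (hb : b ∈ lcs Γ q)
    (hc : c ∈ lcs Γ r) : χ ⁅⁅a, b⁆, c⁆ + χ ⁅⁅b, c⁆, a⁆ + χ ⁅⁅c, a⁆, b⁆ = 0 := by
  have key := commutatorElement_commutatorElement_conj_mul a b c
  have e : ∀ {i j k : ℕ} {x y z : Γ}, x ∈ lcs Γ i → y ∈ lcs Γ j → z ∈ lcs Γ k →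
      i + j + k = p + q + r → ∀ g, χ ⁅⁅x, y⁆, g * z * g⁻¹⁆ = χ ⁅⁅x, y⁆, z⁆ ∧
        ⁅⁅x, y⁆, g * z * g⁻¹⁆ ∈ lcs Γ (p + q + r + 2) := by
    intro i j k x y z hx hy hz hijk g
    have hl : i + j + 1 + k + 1 = p + q + r + 2 := by omega
    refine ⟨map_commutator_conj (by rwa [hl]) (commutator_mem_lcs hx hy) hz g, ?_⟩
    rw [← hl]
    exact commutator_mem_lcs (commutator_mem_lcs hx hy)
      ((inferInstance : (lcs Γ k).Normal).conj_mem _ hz _)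
  obtain ⟨e1, m1⟩ := e ha hb hc rfl b
  obtain ⟨e2, m2⟩ := e hb hc ha (by omega) c
  obtain ⟨e3, m3⟩ := e hc ha hb (by omega) a
  have := congrArg χ key
  rwa [h.map_mul _ (mul_mem m1 m2) _ m3, h.map_mul _ m1 _ m2, e1, e2, e3, h.map_one] at this

theorem eqOn_of_closure (h : LinOn m χ) (h' : LinOn m χ') {s : Set Γ}
    (hs : lcs Γ m ≤ Subgroup.closure s) (hsm : s ⊆ lcs Γ m) (heq : ∀ u ∈ s, χ u = χ' u) {u : Γ}
    (hu : u ∈ lcs Γ m) : χ u = χ' u := by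
  have hle : Subgroup.closure s ≤ lcs Γ m := (Subgroup.closure_le _).2 hsm
  induction hs hu using Subgroup.closure_induction with
  | mem x hx => exact heq x hx
  | one => rw [h.map_one, h'.map_one]
  | mul x y hx hy ihx ihy =>
    rw [h.map_mul _ (hle hx) _ (hle hy), h'.map_mul _ (hle hx) _ (hle hy), ihx (hle hx),
      ihy (hle hy)]
  | inv x hx ih => rw [h.map_inv (hle hx), h'.map_inv (hle hx), ih (hle hx)]

/-- Two functionals on the `(m+1)`-st term of the lower central series agree as soon as they agree
on the commutators with a generating set. -/
theorem eqOn_of_commutator (h : LinOn (m + 1) χ) (h' : LinOn (m + 1) χ') {s : Set Γ}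
    (hs : Subgroup.closure s = ⊤) (heq : ∀ u ∈ lcs Γ m, ∀ x ∈ s, χ ⁅u, x⁆ = χ' ⁅u, x⁆) {u : Γ}
    (hu : u ∈ lcs Γ (m + 1)) : χ u = χ' u := by
  refine h.eqOn_of_closure h' (s := {g | ∃ v ∈ lcs Γ m, ∃ x ∈ (⊤ : Subgroup Γ), ⁅v, x⁆ = g})
    le_rfl ?_ ?_ hu
  · rintro _ ⟨v, hv, x, -, rfl⟩
    exact commutator_mem_lcs_succ hv x
  · rintro _ ⟨v, hv, x, -, rfl⟩
    have h0 : m + 1 = 0 + m + 1 := by omega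
    exact ((h0 ▸ h).commutator_right (p := 0) hv).eqOn_of_closure
      ((h0 ▸ h').commutator_right (p := 0) hv) (s := s) hs.ge (fun _ _ => Subgroup.mem_top _)
      (fun x hx => heq v hv x hx) (Subgroup.mem_top x)

end LinOn

/-- Commutation is bilinear modulo the second next term, so commutators of generators of one
quotient with generators of the group generate the next quotient. -/
theorem exists_finset_lcs_le (hfg : Group.FG Γ) (m : ℕ) :
    ∃ T : Set Γ, T.Finite ∧ T ⊆ lcs Γ m ∧ lcs Γ m ≤ Subgroup.closure T ⊔ lcs Γ (m + 1) := by
  obtain ⟨S, hS⟩ := Group.fg_def.1 hfg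
  induction m with
  | zero => exact ⟨S, S.finite_toSet, fun _ _ => Subgroup.mem_top _, by rw [hS]; simp⟩
  | succ m ih =>
    obtain ⟨T, hT, hTm, hle⟩ := ih
    refine ⟨Set.image2 (fun t s => ⁅t, s⁆) T S, hT.image2 _ S.finite_toSet, ?_, ?_⟩
    · rintro _ ⟨t, ht, s, -, rfl⟩
      exact commutator_mem_lcs_succ (hTm ht) s
    set K := Subgroup.closure (Set.image2 (fun t s : Γ => ⁅t, s⁆) T S) ⊔ lcs Γ (m + 1 + 1) with hK
    have hKr : lcs Γ (m + 1 + 1) ≤ K := le_sup_right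
    have hconj : ∀ g ∈ K, g ∈ lcs Γ (m + 1) → ∀ x, x * g * x⁻¹ ∈ K := by
      intro g hg hgm x
      rw [show x * g * x⁻¹ = ⁅x, g⁆ * g by simp [commutatorElement_def]]
      exact mul_mem (hKr (commutator_mem_lcs_succ' hgm x)) hg
    have hgen : ∀ s ∈ S, ∀ u ∈ lcs Γ m, ⁅u, s⁆ ∈ K := by
      intro s hs u hu
      let A : Subgroup Γ :=
        { carrier := {u | u ∈ lcs Γ m ∧ ⁅u, s⁆ ∈ K}
          one_mem' := ⟨one_mem _, by simp [one_mem]⟩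
          mul_mem' := by
            rintro a b ⟨ha, ha'⟩ ⟨hb, hb'⟩
            refine ⟨mul_mem ha hb, ?_⟩
            rw [commutatorElement_mul_left_eq_conj_mul]
            exact mul_mem (hconj _ hb' (commutator_mem_lcs_succ hb s) _) ha'
          inv_mem' := by
            rintro a ⟨ha, ha'⟩
            refine ⟨inv_mem ha, ?_⟩
            rw [commutatorElement_inv_left]
            have h1 : ⁅s, a⁆ ∈ K := by rw [← commutatorElement_inv]; exact inv_mem ha'
            simpa using hconj _ h1 (commutator_mem_lcs_succ' ha s) a⁻¹ }
      have hA : Subgroup.closure T ⊔ lcs Γ (m + 1) ≤ A := by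
        refine sup_le ((Subgroup.closure_le _).2 fun t ht => ⟨hTm ht, ?_⟩) fun v hv =>
          ⟨lcs_succ_le m hv, hKr (commutator_mem_lcs_succ hv s)⟩
        exact (le_sup_left : _ ≤ K) (Subgroup.subset_closure ⟨t, ht, s, hs, rfl⟩)
      exact (hA (hle hu)).2
    refine Subgroup.commutator_le.2 fun u hu x _ => ?_
    have hx : x ∈ Subgroup.closure (S : Set Γ) := by rw [hS]; trivial
    induction hx using Subgroup.closure_induction with
    | mem x hx => exact hgen x hx u hu
    | one => simp [one_mem]
    | mul x y _ _ ihx ihy =>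
      rw [commutatorElement_mul_right_eq_mul_conj, mul_assoc, mul_assoc, ← mul_assoc x]
      exact mul_mem (ihx trivial) (hconj _ (ihy trivial) (commutator_mem_lcs_succ hu y) x)
    | inv x _ ih =>
      rw [commutatorElement_inv_right]
      have h1 : ⁅x, u⁆ ∈ K := by rw [← commutatorElement_inv]; exact inv_mem (ih trivial)
      simpa using hconj _ h1 (commutator_mem_lcs_succ' hu x) x⁻¹

end LowerCentralSeries

/-! ### Coordinates on subgroups of finitely generated abelian groups -/

section Coordinates

/-- Coordinates on a subgroup of a finitely generated abelian group, controlled by functionals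
defined on the whole group. -/
theorem AddSubgroup.exists_coordinates {L : Type*} [AddCommGroup L] [Module.Finite ℤ L]
    (Q : AddSubgroup L) :
    ∃ (r : ℕ) (y : Fin r → L) (χ : Fin r → L →+ ℤ) (T : Set L), T.Finite ∧ T ⊆ Q ∧
      (∀ s, y s ∈ Q) ∧ ∀ x ∈ Q, ∃ a : Fin r → ℤ, (∀ s, |a s| ≤ |χ s x|) ∧
        x - ∑ s, a s • y s ∈ T := by
  classical
  let tor := Submodule.torsion ℤ L
  have hfin : Finite tor := Module.finite_of_fg_torsion _ Submodule.torsion_isTorsion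
  let π := tor.mkQ
  let Q' : Submodule ℤ (L ⧸ tor) := (AddSubgroup.toIntSubmodule Q).map π
  let b := Module.Free.chooseBasis ℤ (L ⧸ tor)
  -- Stacked bases: a coordinate in the basis of `Q'` is an ambient coordinate divided by a nonzero
  -- integer, hence no larger. This is what lets functionals on the whole group control coordinates
  -- on the subgroup.
  obtain ⟨r, snf⟩ := Submodule.smithNormalForm b Q'
  have hlift : ∀ s, ∃ y ∈ Q, π y = snf.bN s := fun s => (snf.bN s).2
  choose y hyQ hy using hlift
  refine ⟨r, y, fun s => ((snf.bM.coord (snf.f s)).comp π).toAddMonoidHom, (tor : Set L) ∩ Q,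
    (Set.toFinite (tor : Set L)).inter_of_left _, Set.inter_subset_right, hyQ, fun x hx => ?_⟩
  let q : Q' := ⟨π x, Submodule.mem_map_of_mem hx⟩
  refine ⟨fun s => snf.bN.repr q s, fun s => ?_, ?_, ?_⟩
  · have ha : snf.a s ≠ 0 := by
      intro h
      have := snf.snf s
      rw [h, zero_smul] at this
      exact snf.bN.ne_zero s (Subtype.ext this)
    have h1 : snf.bM.repr (π x) (snf.f s) = snf.bN.repr q s * snf.a s := by
      have h2 : π x = ∑ i, snf.bN.repr q i • snf.a i • snf.bM (snf.f i) := by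
        have := congrArg Subtype.val (snf.bN.sum_repr q)
        rw [Submodule.coe_sum] at this
        simp only [Submodule.coe_smul, snf.snf] at this
        exact this.symm
      rw [h2]
      simp only [map_sum, map_smul, Module.Basis.repr_self, Finsupp.coe_finsetSum,
        Finset.sum_apply, Finsupp.smul_apply, Finsupp.single_apply, smul_eq_mul,
        EmbeddingLike.apply_eq_iff_eq]
      simp
    change |snf.bN.repr q s| ≤ |snf.bM.repr (π x) (snf.f s)|
    rw [h1, abs_mul]
    exact le_mul_of_one_le_right (abs_nonneg _) (Int.one_le_abs ha)
  · have h2 : π x = ∑ i, snf.bN.repr q i • π (y i) := by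
      have := congrArg Subtype.val (snf.bN.sum_repr q)
      rw [Submodule.coe_sum] at this
      simp only [Submodule.coe_smul] at this
      simp only [hy]
      exact this.symm
    have : π (x - ∑ s, snf.bN.repr q s • y s) = 0 := by
      rw [map_sub, h2, map_sum]
      simp
    exact (Submodule.Quotient.mk_eq_zero tor).1 this
  · exact Q.sub_mem hx (Q.sum_mem fun s _ => Q.zsmul_mem (hyQ s) _)

/-- Coordinates on a subgroup `Q` of `P` modulo `N`, where `P / N` is finitely generated abelian. -/
theorem Subgroup.exists_coordinates {Γ : Type*} [Group Γ] {P N Q : Subgroup Γ} (hNP : N ≤ P)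
    (hN : N.Normal) (hcomm : ⁅P, P⁆ ≤ N) {S : Set Γ} (hS : S.Finite) (hSP : S ⊆ P)
    (hP : P ≤ closure S ⊔ N) (hQ : Q ≤ P) :
    ∃ (r : ℕ) (y : Fin r → Γ) (χ : Fin r → Γ → ℤ) (T : Set Γ), T.Finite ∧ T ⊆ Q ∧
      (∀ s, y s ∈ Q) ∧
      (∀ s, (∀ u ∈ P, ∀ v ∈ P, χ s (u * v) = χ s u + χ s v) ∧ ∀ u ∈ N, χ s u = 0) ∧
      ∀ u ∈ Q, ∃ a : Fin r → ℤ, (∀ s, |a s| ≤ |χ s u|) ∧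
        ∃ τ ∈ T, ((List.ofFn fun s => y s ^ a s).prod * τ)⁻¹ * u ∈ N := by
  classical
  let N' : Subgroup P := N.subgroupOf P
  let _ : CommGroup (P ⧸ N') :=
    { (inferInstance : Group (P ⧸ N')) with
      mul_comm := by
        intro a b
        induction a using QuotientGroup.induction_on with | H a
        induction b using QuotientGroup.induction_on with | H b
        rw [← QuotientGroup.mk_mul, ← QuotientGroup.mk_mul, QuotientGroup.eq]
        have : (a * b)⁻¹ * (b * a) = ⁅b⁻¹, a⁻¹⁆ := by simp [commutatorElement_def, mul_assoc]
        rw [this]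
        exact hcomm (commutator_mem_commutator (b⁻¹).2 (a⁻¹).2) }
  let π : P →* P ⧸ N' := QuotientGroup.mk' N'
  have hker : ∀ u : P, π u = 1 ↔ (u : Γ) ∈ N := fun u => by
    rw [← MonoidHom.mem_ker, QuotientGroup.ker_mk', mem_subgroupOf]
  have hfg : Group.FG (P ⧸ N') := by
    refine Group.fg_iff.2 ⟨π '' (P.subtype ⁻¹' S), ?_,
      (hS.preimage P.subtype_injective.injOn).image _⟩
    rw [eq_top_iff]
    rintro x -
    obtain ⟨⟨u, hu⟩, rfl⟩ := QuotientGroup.mk'_surjective N' x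
    rw [← MonoidHom.map_closure]
    obtain ⟨v, hv, n, hn, hvn⟩ := Subgroup.mem_sup_of_normal_right.1 (hP hu)
    have hvP : closure S ≤ P := (closure_le _).2 hSP
    have hv' : (⟨v, hvP hv⟩ : P) ∈ closure (P.subtype ⁻¹' S) := by
      have h1 : (closure (P.subtype ⁻¹' S)).map P.subtype = closure S := by
        rw [MonoidHom.map_closure, Set.image_preimage_eq_of_subset]
        simpa using hSP
      obtain ⟨w, hw, hwv⟩ := h1.ge hv
      have : (⟨v, hvP hv⟩ : P) = w := Subtype.ext hwv.symm
      rwa [this]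
    refine ⟨_, hv', ?_⟩
    have hn1 := (hker ⟨n, hNP hn⟩).2 hn
    have : (⟨u, hu⟩ : P) = ⟨v, hvP hv⟩ * ⟨n, hNP hn⟩ := Subtype.ext hvn.symm
    change π ⟨v, hvP hv⟩ = π _
    rw [this, map_mul, hn1, mul_one]
  have : AddGroup.FG (Additive (P ⧸ N')) := inferInstance
  have : Module.Finite ℤ (Additive (P ⧸ N')) := Module.Finite.iff_addGroup_fg.2 inferInstance
  obtain ⟨r, y, χ, T, hT, hTQ, hyQ, hco⟩ := AddSubgroup.exists_coordinates
    (Subgroup.toAddSubgroup ((Q.subgroupOf P).map π))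
  have hlift : ∀ x : Additive (P ⧸ N'), x ∈ Subgroup.toAddSubgroup ((Q.subgroupOf P).map π) →
      ∃ u : P, (u : Γ) ∈ Q ∧ Additive.ofMul (π u) = x := by
    rintro x ⟨u, hu, h⟩
    exact ⟨u, hu, h⟩
  choose! σ hσQ hσ using hlift
  -- The functionals are made total by the value 0 outside `P`; only their values on `P` matter.
  refine ⟨r, fun s => σ (y s), fun s u => if h : u ∈ P then χ s (Additive.ofMul (π ⟨u, h⟩)) else 0,
    (fun x => (σ x : Γ)) '' T, hT.image _, ?_, fun s => hσQ _ (hyQ s), fun s => ⟨?_, ?_⟩, ?_⟩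
  · rintro _ ⟨x, hx, rfl⟩
    exact hσQ _ (hTQ hx)
  · intro u hu v hv
    beta_reduce
    rw [dif_pos hu, dif_pos hv, dif_pos (mul_mem hu hv), ← map_add, ← ofMul_mul, ← map_mul]
    rfl
  · intro u hu
    beta_reduce
    rw [dif_pos (hNP hu), (hker ⟨u, hNP hu⟩).2 hu, ofMul_one, map_zero]
  · intro u hu
    obtain ⟨a, ha, hau⟩ := hco (Additive.ofMul (π ⟨u, hQ hu⟩)) ⟨⟨u, hQ hu⟩, hu, rfl⟩
    refine ⟨a, fun s => by beta_reduce; rw [dif_pos (hQ hu)]; exact ha s, _, ⟨_, hau, rfl⟩, ?_⟩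
    set t := Additive.ofMul (π ⟨u, hQ hu⟩) - ∑ s, a s • y s with ht
    have h1 : ((List.ofFn fun s => ((σ (y s) : P) : Γ) ^ a s).prod * (σ t : Γ))⁻¹ * u =
        (((List.ofFn fun s => σ (y s) ^ a s).prod * σ t)⁻¹ * ⟨u, hQ hu⟩ : P) := by
      have : (((List.ofFn fun s => σ (y s) ^ a s).prod : P) : Γ) =
          (List.ofFn fun s => ((σ (y s) : P) : Γ) ^ a s).prod := by
        have := map_list_prod P.subtype (List.ofFn fun s => σ (y s) ^ a s)
        rw [List.map_ofFn] at this
        exact this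
      rw [← this]; rfl
    have h2 : π (List.ofFn fun s => σ (y s) ^ a s).prod = ∏ s, π (σ (y s)) ^ a s := by
      rw [map_list_prod, List.map_ofFn, List.prod_ofFn]
      simp
    rw [h1, ← hker, map_mul π, map_inv π, map_mul π, h2, inv_mul_eq_one]
    apply Additive.ofMul.injective
    rw [ofMul_mul, hσ t (hTQ hau), ofMul_prod]
    simp only [ofMul_zpow, hσ _ (hyQ _)]
    rw [ht, add_sub_cancel]

end Coordinates

/-! ### The free associative ring with its `ℓ¹` norm and grading -/

section TensorAlgebra

open MonoidAlgebra

/-- The free associative ring on `d` generators. -/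
abbrev Tens (d : ℕ) := MonoidAlgebra ℤ (FreeMonoid (Fin d))

namespace Tens

variable {d : ℕ}

/-- The generators of the free associative ring. -/
noncomputable def gen (i : Fin d) : Tens d := single (FreeMonoid.of i) 1

/-- The sum of the absolute values of the coefficients. -/
noncomputable def nrm (p : Tens d) : ℕ := p.coeff.sum fun _ c => c.natAbs

/-- `p` is a combination of words of length `j`. -/
def IsHomog (j : ℕ) (p : Tens d) : Prop := ∀ J, p.coeff J ≠ 0 → J.length = j

theorem nrm_eq_sum {p : Tens d} {s : Finset (FreeMonoid (Fin d))} (h : p.coeff.support ⊆ s) :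
    nrm p = ∑ J ∈ s, (p.coeff J).natAbs :=
  Finsupp.sum_of_support_subset _ h _ fun _ _ => rfl

theorem nrm_zero : nrm (0 : Tens d) = 0 := by simp [nrm]

theorem nrm_single (J : FreeMonoid (Fin d)) (c : ℤ) : nrm (single J c) = c.natAbs := by
  simp [nrm]

theorem nrm_one : nrm (1 : Tens d) = 1 := nrm_single 1 1

theorem nrm_neg (p : Tens d) : nrm (-p) = nrm p := by
  rw [nrm_eq_sum (s := p.coeff.support) (by simp), nrm_eq_sum (p := p) subset_rfl]
  simp

theorem nrm_add_le (p q : Tens d) : nrm (p + q) ≤ nrm p + nrm q := by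
  classical
  rw [nrm_eq_sum (p := p + q) (s := p.coeff.support ∪ q.coeff.support)
    (by rw [coeff_add]; exact Finsupp.support_add), nrm_eq_sum (p := p) Finset.subset_union_left,
    nrm_eq_sum (p := q) Finset.subset_union_right, ← Finset.sum_add_distrib]
  exact Finset.sum_le_sum fun J _ => by simpa using Int.natAbs_add_le _ _

theorem nrm_sum_le {ι : Type*} (s : Finset ι) (f : ι → Tens d) :
    nrm (∑ i ∈ s, f i) ≤ ∑ i ∈ s, nrm (f i) :=
  Finset.le_sum_of_subadditive _ nrm_zero.le nrm_add_le _ _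

theorem nrm_mul_le (p q : Tens d) : nrm (p * q) ≤ nrm p * nrm q := by
  rw [mul_def, Finsupp.sum]
  refine (nrm_sum_le _ _).trans ?_
  rw [nrm, Finsupp.sum, Finset.sum_mul]
  refine Finset.sum_le_sum fun J _ => ?_
  rw [Finsupp.sum]
  refine (nrm_sum_le _ _).trans ?_
  rw [nrm, Finsupp.sum, Finset.mul_sum]
  exact Finset.sum_le_sum fun K _ => by rw [nrm_single, Int.natAbs_mul]

theorem isHomog_zero (j : ℕ) : IsHomog j (0 : Tens d) := fun J h => by simp at h

theorem isHomog_one : IsHomog 0 (1 : Tens d) := fun J h => by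
  classical
  rw [one_def, coeff_single, Finsupp.single_apply] at h
  by_cases hJ : 1 = J
  · rw [← hJ]; rfl
  · simp [hJ] at h

theorem isHomog_gen (i : Fin d) : IsHomog 1 (gen i) := fun J h => by
  classical
  rw [gen, coeff_single, Finsupp.single_apply] at h
  by_cases hJ : FreeMonoid.of i = J
  · rw [← hJ]; rfl
  · simp [hJ] at h

theorem IsHomog.neg {j : ℕ} {p : Tens d} (hp : IsHomog j p) : IsHomog j (-p) := fun J h =>
  hp J (by simpa using h)

theorem IsHomog.add {j : ℕ} {p q : Tens d} (hp : IsHomog j p) (hq : IsHomog j q) :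
    IsHomog j (p + q) := fun J h => by
  by_cases h' : p.coeff J = 0
  · exact hq J (by simpa [h'] using h)
  · exact hp J h'

theorem IsHomog.sum {ι : Type*} {j : ℕ} {s : Finset ι} {f : ι → Tens d}
    (h : ∀ i ∈ s, IsHomog j (f i)) : IsHomog j (∑ i ∈ s, f i) :=
  Finset.sum_induction _ (IsHomog j) (fun _ _ => IsHomog.add) (isHomog_zero j) h

theorem IsHomog.mul {i j : ℕ} {p q : Tens d} (hp : IsHomog i p) (hq : IsHomog j q) :
    IsHomog (i + j) (p * q) := fun J h => by
  classical
  rw [MonoidAlgebra.coeff_mul] at h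
  obtain ⟨K, hK, h⟩ := Finset.exists_ne_zero_of_sum_ne_zero h
  obtain ⟨L, hL, h⟩ := Finset.exists_ne_zero_of_sum_ne_zero h
  have hJ : K * L = J := by
    by_contra hne
    simp [hne] at h
  rw [← hJ, FreeMonoid.length_mul, hp K (Finsupp.mem_support_iff.1 hK),
    hq L (Finsupp.mem_support_iff.1 hL)]

/-- The linear functional with prescribed values on words. -/
noncomputable def lin (f : FreeMonoid (Fin d) → ℤ) : Tens d →+ ℤ :=
  (Finsupp.liftAddHom fun J => AddMonoidHom.mulRight (f J)).comp coeffAddEquiv.toAddMonoidHom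

theorem lin_apply (f : FreeMonoid (Fin d) → ℤ) (p : Tens d) :
    lin f p = ∑ J ∈ p.coeff.support, p.coeff J * f J := rfl

theorem lin_single (f : FreeMonoid (Fin d) → ℤ) (J : FreeMonoid (Fin d)) (c : ℤ) :
    lin f (single J c) = c * f J := by
  simp [lin]

theorem lin_gen (f : FreeMonoid (Fin d) → ℤ) (i : Fin d) : lin f (gen i) = f (FreeMonoid.of i) := by
  rw [gen, lin_single, one_mul]

theorem lin_gen_mul (f : FreeMonoid (Fin d) → ℤ) (i : Fin d) (p : Tens d) :
    lin f (gen i * p) = lin (fun J => f (FreeMonoid.of i * J)) p := by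
  induction p using MonoidAlgebra.induction_linear with
  | zero => simp
  | add p q hp hq => rw [mul_add, map_add, map_add, hp, hq]
  | single J c => rw [gen, single_mul_single, lin_single, lin_single, one_mul]

theorem lin_mul_gen (f : FreeMonoid (Fin d) → ℤ) (i : Fin d) (p : Tens d) :
    lin f (p * gen i) = lin (fun J => f (J * FreeMonoid.of i)) p := by
  induction p using MonoidAlgebra.induction_linear with
  | zero => simp
  | add p q hp hq => rw [add_mul, map_add, map_add, hp, hq]
  | single J c => rw [gen, single_mul_single, lin_single, lin_single, mul_one]

theorem IsHomog.lin_congr {j : ℕ} {p : Tens d} (hp : IsHomog j p) {f g : FreeMonoid (Fin d) → ℤ}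
    (h : ∀ J, J.length = j → f J = g J) : lin f p = lin g p := by
  rw [lin_apply, lin_apply]
  exact Finset.sum_congr rfl fun J hJ => by rw [h J (hp J (Finsupp.mem_support_iff.1 hJ))]

theorem IsHomog.abs_lin_le {j : ℕ} {p : Tens d} (hp : IsHomog j p) {f : FreeMonoid (Fin d) → ℤ}
    {C : ℕ} (h : ∀ J, J.length = j → |f J| ≤ C) : |lin f p| ≤ nrm p * C := by
  rw [lin_apply, nrm, Finsupp.sum, Nat.cast_sum, Finset.sum_mul]
  refine (Finset.abs_sum_le_sum_abs _ _).trans (Finset.sum_le_sum fun J hJ => ?_)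
  rw [abs_mul, Int.natCast_natAbs]
  exact mul_le_mul_of_nonneg_left (h J (hp J (Finsupp.mem_support_iff.1 hJ))) (abs_nonneg _)

theorem IsHomog.exists_abs_lin_le (j : ℕ) (f : FreeMonoid (Fin d) → ℤ) :
    ∃ C : ℕ, ∀ p : Tens d, IsHomog j p → |lin f p| ≤ nrm p * C := by
  have hfin : {J : FreeMonoid (Fin d) | J.length = j}.Finite := List.finite_length_eq (Fin d) j
  obtain ⟨C, hC⟩ := (hfin.image fun J => (f J).natAbs).bddAbove
  refine ⟨C, fun p hp => hp.abs_lin_le fun J hJ => ?_⟩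
  rw [← Int.natCast_natAbs]
  exact_mod_cast hC ⟨J, hJ, rfl⟩

end Tens

end TensorAlgebra

/-! ### The Magnus expansion and the Dynkin–Specht–Wever identity -/

section Magnus

open Tens

/-- The unit `1 + a X` of the ring of power series. -/
noncomputable def PowerSeries.unitOneAdd {A : Type*} [Ring A] (a : A) : (PowerSeries A)ˣ where
  val := 1 + C a * X
  inv := mk fun j => (-a) ^ j
  val_inv := by
    ext n
    cases n with
    | zero => simp [add_mul]
    | succ n => simp [add_mul, mul_assoc, coeff_succ_X_mul, coeff_one, pow_succ']
  inv_val := by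
    ext n
    cases n with
    | zero => simp [mul_add]
    | succ n =>
      rw [mul_add, ← mul_assoc]
      simp [coeff_succ_mul_X, coeff_one, pow_succ]

variable {d : ℕ}

/-- The Magnus embedding of the free group. -/
noncomputable def magnus : FreeGroup (Fin d) →* (PowerSeries (Tens d))ˣ :=
  -- The central variable of the power series records the degree, so its coefficients are the
  -- homogeneous components.
  FreeGroup.lift fun i => PowerSeries.unitOneAdd (gen i)

/-- The homogeneous components of the Magnus embedding. -/
noncomputable def mu (j : ℕ) (w : FreeGroup (Fin d)) : Tens d :=
  PowerSeries.coeff j (magnus w : PowerSeries (Tens d))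

theorem mu_mul (j : ℕ) (v w : FreeGroup (Fin d)) :
    mu j (v * w) = ∑ p ∈ Finset.HasAntidiagonal.antidiagonal j, mu p.1 v * mu p.2 w := by
  rw [mu, map_mul, Units.val_mul, PowerSeries.coeff_mul]
  rfl

theorem mu_one (j : ℕ) : mu j (1 : FreeGroup (Fin d)) = if j = 0 then 1 else 0 := by
  rw [mu, map_one, Units.val_one, PowerSeries.coeff_one]

theorem mu_of (j : ℕ) (i : Fin d) :
    mu j (FreeGroup.of i) = if j = 0 then 1 else if j = 1 then gen i else 0 := by
  rw [mu, magnus, FreeGroup.lift_apply_of]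
  rcases j with _ | _ | j <;>
    simp [PowerSeries.unitOneAdd, PowerSeries.coeff_one]

theorem mu_of_inv (j : ℕ) (i : Fin d) : mu j (FreeGroup.of i)⁻¹ = (-gen i) ^ j := by
  rw [mu, magnus, map_inv, FreeGroup.lift_apply_of]
  exact PowerSeries.coeff_mk (R := Tens d) j fun j => (-gen i) ^ j

theorem mu_zero (w : FreeGroup (Fin d)) : mu 0 w = 1 := by
  induction w using FreeGroup.induction_on with
  | C1 => simp [mu_one]
  | of i => simp [mu_of]
  | inv_of i _ => simp [mu_of_inv]
  | mul v w hv hw => simp [mu_mul, hv, hw]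

theorem isHomog_mu (j : ℕ) (w : FreeGroup (Fin d)) : IsHomog j (mu j w) := by
  induction w using FreeGroup.induction_on generalizing j with
  | C1 =>
    rw [mu_one]
    split_ifs with h
    · rw [h]; exact isHomog_one
    · exact isHomog_zero j
  | of i =>
    rw [mu_of]
    split_ifs with h h
    · rw [h]; exact isHomog_one
    · rw [h]; exact isHomog_gen i
    · exact isHomog_zero j
  | inv_of i _ =>
    rw [mu_of_inv]
    induction j with
    | zero => exact isHomog_one
    | succ j ih => exact ih.mul (isHomog_gen i).neg
  | mul v w hv hw =>
    rw [mu_mul]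
    exact IsHomog.sum fun p hp => Finset.HasAntidiagonal.mem_antidiagonal.1 hp ▸ (hv _).mul (hw _)

theorem mu_one_mul (v w : FreeGroup (Fin d)) : mu 1 (v * w) = mu 1 v + mu 1 w := by
  simp [mu_mul, Finset.Nat.antidiagonal_succ, mu_zero, add_comm]

theorem mu_add_two_mul (n : ℕ) (v w : FreeGroup (Fin d)) :
    mu (n + 2) (v * w) = mu (n + 2) v + mu (n + 2) w +
      ∑ p ∈ Finset.HasAntidiagonal.antidiagonal n, mu (p.1 + 1) v * mu (p.2 + 1) w := by
  rw [mu_mul, Finset.Nat.sum_antidiagonal_succ, Finset.Nat.sum_antidiagonal_succ']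
  simp only [mu_zero]
  noncomm_ring

/-- The Magnus expansion of `w` has no terms in the degrees `1, …, i`. -/
def InDim (i : ℕ) (w : FreeGroup (Fin d)) : Prop := ∀ j, 0 < j → j ≤ i → mu j w = 0

namespace InDim

variable {i j : ℕ} {u v x : FreeGroup (Fin d)}

theorem mu_mul_left (hu : InDim i u) (hj : 0 < j) (hji : j ≤ i + 1) (x : FreeGroup (Fin d)) :
    mu j (u * x) = mu j u + mu j x := by
  rcases j with _ | _ | n
  · omega
  · exact mu_one_mul u x
  · rw [mu_add_two_mul, Finset.sum_eq_zero, add_zero]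
    intro p hp
    have := Finset.HasAntidiagonal.mem_antidiagonal.1 hp
    rw [hu _ (by omega) (by omega), zero_mul]

theorem mu_mul_right (hu : InDim i u) (hj : 0 < j) (hji : j ≤ i + 1) (x : FreeGroup (Fin d)) :
    mu j (x * u) = mu j u + mu j x := by
  rcases j with _ | _ | n
  · omega
  · rw [mu_one_mul, add_comm]
  · rw [mu_add_two_mul, Finset.sum_eq_zero, add_zero, add_comm]
    intro p hp
    have := Finset.HasAntidiagonal.mem_antidiagonal.1 hp
    rw [hu _ (by omega) (by omega), mul_zero]

theorem mu_add_two_mul_left (hu : InDim i u) (x : FreeGroup (Fin d)) :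
    mu (i + 2) (u * x) = mu (i + 2) u + mu (i + 2) x + mu (i + 1) u * mu 1 x := by
  rw [mu_add_two_mul, Finset.sum_eq_single (i, 0)]
  · intro p hp hne
    have := Finset.HasAntidiagonal.mem_antidiagonal.1 hp
    rw [hu (p.1 + 1) (by omega), zero_mul]
    by_contra hlt
    exact hne (Prod.ext (by dsimp only; omega) (by dsimp only; omega))
  · simp

theorem mu_add_two_mul_right (hu : InDim i u) (x : FreeGroup (Fin d)) :
    mu (i + 2) (x * u) = mu (i + 2) u + mu (i + 2) x + mu 1 x * mu (i + 1) u := by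
  rw [mu_add_two_mul, Finset.sum_eq_single (0, i), add_comm (mu (i + 2) x)]
  · intro p hp hne
    have := Finset.HasAntidiagonal.mem_antidiagonal.1 hp
    rw [hu (p.2 + 1) (by omega), mul_zero]
    by_contra hlt
    exact hne (Prod.ext (by dsimp only; omega) (by dsimp only; omega))
  · simp

theorem one : InDim i (1 : FreeGroup (Fin d)) := fun j hj _ => by rw [mu_one, if_neg hj.ne']

theorem mul (hu : InDim i u) (hv : InDim i v) : InDim i (u * v) := fun j hj hji => by
  rw [hu.mu_mul_left hj (by omega), hu j hj hji, hv j hj hji, add_zero]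

theorem mu_inv (hu : InDim i u) (hj : 0 < j) (hji : j ≤ i + 1) : mu j u⁻¹ = -mu j u := by
  have := hu.mu_mul_left hj hji u⁻¹
  rw [mul_inv_cancel, mu_one, if_neg hj.ne'] at this
  exact (neg_eq_of_add_eq_zero_right this.symm).symm

theorem inv (hu : InDim i u) : InDim i u⁻¹ := fun j hj hji => by
  rw [hu.mu_inv hj (by omega), hu j hj hji, neg_zero]

theorem commutator (hu : InDim i u) (x : FreeGroup (Fin d)) : InDim (i + 1) ⁅u, x⁆ := by
  -- Compare the two sides of `⁅u, x⁆ * (x * u) = u * x`: up to degree `i + 1`, both `u * x` and `x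
  -- * u` have the sum of the components of `u` and `x`.
  have key : ∀ k ≤ i + 1, InDim k ⁅u, x⁆ := by
    intro k
    induction k with
    | zero => exact fun _ j hj hj' => by omega
    | succ k ih =>
      intro hk j hj hjk
      have hc := (ih (by omega)).mu_mul_left (j := j) hj hjk (x * u)
      rw [show ⁅u, x⁆ * (x * u) = u * x by simp [commutatorElement_def],
        hu.mu_mul_left hj (by omega), hu.mu_mul_right hj (by omega)] at hc
      simpa using hc
  exact key _ le_rfl

/-- The degree `i + 2` is the first in which `u * x` and `x * u` can differ, and there the
difference is the ring commutator of the leading terms. -/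
theorem mu_commutator (hu : InDim i u) (x : FreeGroup (Fin d)) :
    mu (i + 2) ⁅u, x⁆ = mu (i + 1) u * mu 1 x - mu 1 x * mu (i + 1) u := by
  have hc := (hu.commutator x).mu_mul_left (j := i + 2) (by omega) le_rfl (x * u)
  rw [show ⁅u, x⁆ * (x * u) = u * x by simp [commutatorElement_def],
    hu.mu_add_two_mul_left, hu.mu_add_two_mul_right] at hc
  rw [eq_sub_iff_add_eq, ← add_right_inj (mu (i + 2) u + mu (i + 2) x), hc]
  abel

theorem of_mem_lcs {i : ℕ} {u : FreeGroup (Fin d)} (hu : u ∈ lcs _ i) : InDim i u := by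
  induction i generalizing u with
  | zero => exact fun j hj hj' => by omega
  | succ i ih =>
    induction hu using Subgroup.closure_induction with
    | mem _ h =>
      obtain ⟨v, hv, x, -, rfl⟩ := h
      exact (ih hv).commutator x
    | one => exact one
    | mul _ _ _ _ hx hy => exact hx.mul hy
    | inv _ _ hx => exact hx.inv

end InDim

theorem linOn_lin_mu (p : ℕ) (f : FreeMonoid (Fin d) → ℤ) :
    LinOn p fun u => lin f (mu (p + 1) u) where
  map_mul u hu v _ := by
    rw [(InDim.of_mem_lcs hu).mu_mul_left (by omega) le_rfl, map_add]
  map_succ u hu := by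
    rw [InDim.of_mem_lcs hu _ (by omega) le_rfl, map_zero]

/-- The left-normed commutator `[⋯[[y, x_{j₁}], x_{j₂}], ⋯, x_{j_p}]`. -/
def commFold (y : FreeGroup (Fin d)) (J : List (Fin d)) : FreeGroup (Fin d) :=
  J.foldl (fun g j => ⁅g, FreeGroup.of j⁆) y

theorem commFold_append (y : FreeGroup (Fin d)) (J : List (Fin d)) (j : Fin d) :
    commFold y (J ++ [j]) = ⁅commFold y J, FreeGroup.of j⁆ := by
  simp [commFold]

theorem closure_range_of : Subgroup.closure (Set.range (FreeGroup.of : Fin d → _)) = ⊤ :=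
  FreeGroup.closure_range_of _

/-- Commutation with `u` is computed by the leading term of the Magnus expansion of `u`. -/
theorem LinOn.commutator_eq_lin_mu {p q : ℕ} {χ : FreeGroup (Fin d) → ℤ}
    (h : LinOn (p + q + 1) χ) {y u : FreeGroup (Fin d)} (hy : y ∈ lcs _ q) (hu : u ∈ lcs _ p) :
    χ ⁅y, u⁆ = lin (fun J => χ (commFold y J.toList)) (mu (p + 1) u) := by
  induction p generalizing q χ y u with
  | zero =>
    refine (h.commutator_right hy).eqOn_of_closure (linOn_lin_mu 0 _) closure_range_of.ge
      (fun _ _ => Subgroup.mem_top _) ?_ hu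
    rintro _ ⟨j, rfl⟩
    simp [mu_of, lin_gen, commFold]
  | succ p ih =>
    refine (h.commutator_right hy).eqOn_of_commutator (linOn_lin_mu (p + 1) _) closure_range_of
      ?_ hu
    rintro u hu _ ⟨j, rfl⟩
    have hx : FreeGroup.of j ∈ lcs (FreeGroup (Fin d)) 0 := Subgroup.mem_top _
    have e1 : p + 1 + q + 1 = p + q + 1 + 0 + 1 := by omega
    have e2 : p + 1 + q + 1 = p + (q + 1) + 1 := by omega
    have e3 : p + 1 + q + 1 = q + p + 0 + 2 := by omega
    have i1 := ih (LinOn.commutator_left (p := p + q + 1) (q := 0) (e1 ▸ h) hx) hy hu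
    have i2 := ih (e2 ▸ h) (commutator_mem_lcs_succ hy (FreeGroup.of j)) hu
    -- Jacobi gives `χ ⁅y, ⁅u, x⁆⁆ = χ ⁅⁅y, u⁆, x⁆ - χ ⁅⁅y, x⁆, u⁆`. The two terms match the
    -- products of `mu (p + 1) u` with the generator on the right and on the left.
    have jac := (e3 ▸ h).jacobi hy hu hx
    have s1 : χ ⁅⁅u, FreeGroup.of j⁆, y⁆ = -χ ⁅y, ⁅u, FreeGroup.of j⁆⁆ := by
      rw [h.map_commutator_swap (commutator_mem_lcs_succ hu (FreeGroup.of j)) hy, neg_neg]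
    have s2 : χ ⁅⁅FreeGroup.of j, y⁆, u⁆ = -χ ⁅⁅y, FreeGroup.of j⁆, u⁆ := by
      have e4 : p + 1 + q + 1 = q + 1 + p + 1 := by omega
      rw [← commutatorElement_inv y]
      exact (LinOn.commutator_left (p := q + 1) (q := p) (e4 ▸ h) hu).map_inv
        (commutator_mem_lcs_succ hy (FreeGroup.of j))
    rw [(InDim.of_mem_lcs hu).mu_commutator, mu_of, if_neg one_ne_zero, if_pos rfl, map_sub,
      lin_mul_gen, lin_gen_mul]
    simp only [FreeMonoid.toList_mul, FreeMonoid.toList_of, commFold_append] at i1 ⊢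
    rw [← i1]
    have i3 : χ ⁅⁅y, FreeGroup.of j⁆, u⁆ =
      lin (fun J => χ (commFold y ([j] ++ J.toList))) (mu (p + 1) u) := i2
    rw [← i3]
    linarith

/-- The functional on words that a functional on the free group induces through left-normed
commutators. -/
def dynkin (χ : FreeGroup (Fin d) → ℤ) : List (Fin d) → ℤ
  -- Arbitrary value: only words of positive length occur in the components used.
  | [] => 0
  | j :: J => χ (commFold (FreeGroup.of j) J)

/-- The Dynkin–Specht–Wever identity. -/
theorem LinOn.dynkin_specht_wever {p : ℕ} {χ : FreeGroup (Fin d) → ℤ} (h : LinOn p χ)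
    {u : FreeGroup (Fin d)} (hu : u ∈ lcs _ p) :
    (p + 1) * χ u = lin (fun J => dynkin χ J.toList) (mu (p + 1) u) := by
  have hsmul : ∀ {p : ℕ} {χ : FreeGroup (Fin d) → ℤ}, LinOn p χ →
      LinOn p fun u => ((p : ℤ) + 1) * χ u := fun h =>
    ⟨fun u hu v hv => by rw [h.map_mul u hu v hv, mul_add], fun u hu => by
      rw [h.map_succ u hu, mul_zero]⟩
  induction p generalizing χ u with
  | zero =>
    refine (hsmul h).eqOn_of_closure (linOn_lin_mu 0 _) closure_range_of.ge
      (fun _ _ => Subgroup.mem_top _) ?_ hu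
    rintro _ ⟨j, rfl⟩
    simp [mu_of, lin_gen, commFold, dynkin]
  | succ p ih =>
    refine (hsmul h).eqOn_of_commutator (linOn_lin_mu (p + 1) _) closure_range_of ?_ hu
    rintro u hu _ ⟨j, rfl⟩
    have hx : FreeGroup.of j ∈ lcs (FreeGroup (Fin d)) 0 := Subgroup.mem_top _
    have h' : LinOn (p + 0 + 1) χ := h
    -- The product with the generator on the right contributes `(p + 1) * χ ⁅u, x⁆` by induction;
    -- subtracting the product on the left contributes `-χ ⁅x, u⁆ = χ ⁅u, x⁆`. Together they give
    -- the factor `p + 2`.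
    have i1 := ih (LinOn.commutator_left (q := 0) h' hx) hu
    have i2 := LinOn.commutator_eq_lin_mu (q := 0) h' hx hu
    have s := LinOn.map_commutator_swap (q := 0) h' hu hx
    rw [(InDim.of_mem_lcs hu).mu_commutator, mu_of, if_neg one_ne_zero, if_pos rfl, map_sub,
      lin_mul_gen, lin_gen_mul]
    have e1 : lin (fun J => dynkin χ (J * FreeMonoid.of j).toList) (mu (p + 1) u) =
        lin (fun J => dynkin (fun v => χ ⁅v, FreeGroup.of j⁆) J.toList) (mu (p + 1) u) := by
      refine (isHomog_mu (p + 1) u).lin_congr fun J hJ => ?_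
      rw [FreeMonoid.toList_mul, FreeMonoid.toList_of]
      rcases hl : J.toList with _ | ⟨k, K⟩
      · have : J.length = 0 := by rw [FreeMonoid.length, hl]; rfl
        omega
      · rw [List.cons_append, dynkin, dynkin, commFold_append]
    have e2 : lin (fun J => dynkin χ (FreeMonoid.of j * J).toList) (mu (p + 1) u) =
        χ ⁅FreeGroup.of j, u⁆ := i2.symm
    rw [e1, e2, ← i1, s]
    push_cast
    ring

end Magnus

/-! ### The quasi-norm given by the Magnus expansion -/

section QuasiNorm

open Tens

variable {d : ℕ}

/-- The homogeneous components of degree `j < N` of the Magnus expansion of `w` have norm at most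
`n ^ j`. -/
def MuBound (N n : ℕ) (w : FreeGroup (Fin d)) : Prop := ∀ j < N, nrm (mu j w) ≤ n ^ j

namespace MuBound

variable {N n m : ℕ} {v w : FreeGroup (Fin d)}

theorem mono (h : MuBound N n w) (hnm : n ≤ m) : MuBound N m w := fun j hj =>
  (h j hj).trans (Nat.pow_le_pow_left hnm j)

theorem one : MuBound N 0 (1 : FreeGroup (Fin d)) := fun j _ => by
  rw [mu_one]
  split_ifs with h
  · rw [h, nrm_one, pow_zero]
  · rw [nrm_zero]; exact zero_le

/-- The convolution of `n^p` and `m^q` is dominated by the binomial expansion of `(n + m)^j`, whose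
coefficients are at least 1. -/
theorem mul (hv : MuBound N n v) (hw : MuBound N m w) : MuBound N (n + m) (v * w) := by
  intro j hj
  rw [mu_mul, (Commute.all n m).add_pow']
  refine (nrm_sum_le _ _).trans (Finset.sum_le_sum fun p hp => ?_)
  have hp' := Finset.HasAntidiagonal.mem_antidiagonal.1 hp
  refine (nrm_mul_le _ _).trans ((Nat.mul_le_mul (hv _ (by omega)) (hw _ (by omega))).trans ?_)
  rw [smul_eq_mul]
  exact Nat.le_mul_of_pos_left _ (Nat.choose_pos (by omega))

theorem of (i : Fin d) : MuBound N 1 (FreeGroup.of i) := fun j _ => by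
  rw [mu_of, one_pow]
  split_ifs
  · rw [nrm_one]
  · simp [gen, nrm_single]
  · rw [nrm_zero]; exact zero_le

theorem of_inv (i : Fin d) : MuBound N 1 (FreeGroup.of i)⁻¹ := fun j _ => by
  rw [mu_of_inv, one_pow]
  induction j with
  | zero => rw [pow_zero, nrm_one]
  | succ j ih =>
    rw [pow_succ]
    refine (nrm_mul_le _ _).trans ?_
    have hg : nrm (-gen i) = 1 := by rw [nrm_neg, gen, nrm_single, Int.natAbs_one]
    rw [hg, mul_one]
    exact ih (Nat.lt_of_succ_lt ‹_›)

theorem mk_list (L : List (Fin d × Bool)) : MuBound N L.length (FreeGroup.mk L) := by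
  induction L with
  | nil => exact one
  | cons a L ih =>
    have : FreeGroup.mk (a :: L) = FreeGroup.mk [a] * FreeGroup.mk L := by simp
    rw [this, List.length_cons, add_comm]
    refine mul ?_ ih
    rcases a with ⟨i, _ | _⟩
    · exact of_inv i
    · exact of i

theorem norm (w : FreeGroup (Fin d)) : MuBound N w.norm w := by
  conv => rhs; rw [← FreeGroup.mk_toWord (x := w)]
  exact mk_list _

end MuBound

/-- Since `u` starts in degree `i + 1`, the degree `j` part of `u^a` grows like a polynomial in `a`
of degree at most `j / (i + 1)`, so exponents up to `n^(i+1)` cost only O(n^j). -/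
theorem exists_nrm_mu_pow_le {i : ℕ} {u : FreeGroup (Fin d)} (hu : InDim i u) (M : ℕ) :
    ∃ C : ℕ, ∀ j < M, ∀ n : ℕ, 1 ≤ n → ∀ a ≤ n ^ (i + 1), nrm (mu j (u ^ a)) ≤ C * n ^ j := by
  induction M with
  | zero => exact ⟨0, fun j hj => absurd hj (by omega)⟩
  | succ M ih =>
    obtain ⟨C, hC⟩ := ih
    rcases M with _ | M
    · refine ⟨1, fun j hj n hn a _ => ?_⟩
      obtain rfl : j = 0 := by omega
      simp [mu_zero, nrm_one]
    set D := ∑ p ∈ Finset.HasAntidiagonal.antidiagonal M, nrm (mu (p.1 + 1) u) * C with hD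
    refine ⟨max C D, fun j hj n hn a ha => ?_⟩
    rcases Nat.lt_succ_iff_lt_or_eq.1 hj with hj | rfl
    · exact (hC j hj n hn a ha).trans (Nat.mul_le_mul_right _ (le_max_left _ _))
    have hn' : 0 < n ^ (i + 1) := Nat.pow_pos hn
    -- Each further factor `u` adds at most `D * n^(M+1) / n^(i+1)` to the norm; the inequality is
    -- multiplied by `n^(i+1)` to stay in `ℕ`.
    have key : ∀ b ≤ n ^ (i + 1), n ^ (i + 1) * nrm (mu (M + 1) (u ^ b)) ≤ b * (D * n ^ (M + 1)) := by
      intro b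
      induction b with
      | zero => intro _; rw [pow_zero, mu_one, if_neg (by omega), nrm_zero]; simp
      | succ b ihb =>
        intro hb
        rw [pow_succ' u b, mu_mul, Finset.Nat.sum_antidiagonal_succ, mu_zero, one_mul]
        have h1 : n ^ (i + 1) * nrm (∑ p ∈ Finset.HasAntidiagonal.antidiagonal M,
            mu (p.1 + 1) u * mu p.2 (u ^ b)) ≤ D * n ^ (M + 1) := by
          refine (Nat.mul_le_mul_left _ (nrm_sum_le _ _)).trans ?_
          rw [hD, Finset.mul_sum, Finset.sum_mul]
          refine Finset.sum_le_sum fun p hp => ?_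
          have hp' := Finset.HasAntidiagonal.mem_antidiagonal.1 hp
          rcases le_or_gt (p.1 + 1) i with hpi | hpi
          · rw [hu _ (by omega) hpi, zero_mul, nrm_zero]; simp
          · calc n ^ (i + 1) * nrm (mu (p.1 + 1) u * mu p.2 (u ^ b))
                ≤ n ^ (i + 1) * (nrm (mu (p.1 + 1) u) * (C * n ^ p.2)) :=
                  Nat.mul_le_mul_left _ ((nrm_mul_le _ _).trans
                    (Nat.mul_le_mul_left _ (hC _ (by omega) n hn b (by omega))))
              _ = nrm (mu (p.1 + 1) u) * C * n ^ (i + 1 + p.2) := by ring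
              _ ≤ _ := Nat.mul_le_mul_left _ (Nat.pow_le_pow_right hn (by omega))
        calc _ ≤ n ^ (i + 1) * (nrm (mu (M + 1) (u ^ b)) +
              nrm (∑ p ∈ Finset.HasAntidiagonal.antidiagonal M,
                mu (p.1 + 1) u * mu p.2 (u ^ b))) :=
              Nat.mul_le_mul_left _ (nrm_add_le _ _)
          _ ≤ b * (D * n ^ (M + 1)) + D * n ^ (M + 1) := by
              rw [mul_add]; exact Nat.add_le_add (ihb (by omega)) h1
          _ = _ := by ring
    have h2 := (key a ha).trans (Nat.mul_le_mul_right _ ha)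
    exact (Nat.le_of_mul_le_mul_left h2 hn').trans (Nat.mul_le_mul_right _ (le_max_right _ _))

theorem exists_muBound_pow {i : ℕ} {u : FreeGroup (Fin d)} (hu : InDim i u) (N : ℕ) :
    ∃ C : ℕ, ∀ n : ℕ, 1 ≤ n → ∀ a ≤ n ^ (i + 1), MuBound N (C * n) (u ^ a) := by
  obtain ⟨C, hC⟩ := exists_nrm_mu_pow_le hu N
  refine ⟨C + 1, fun n hn a ha j hj => ?_⟩
  rcases j with _ | j
  · rw [mu_zero, nrm_one, pow_zero]
  · refine (hC _ hj n hn a ha).trans ?_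
    rw [mul_pow]
    exact Nat.mul_le_mul_right _ ((Nat.le_succ C).trans (Nat.le_self_pow (by omega) _))

theorem exists_muBound_zpow {i : ℕ} {u : FreeGroup (Fin d)} (hu : InDim i u) (N : ℕ) :
    ∃ C : ℕ, ∀ n : ℕ, 1 ≤ n → ∀ a : ℤ, |a| ≤ (n : ℤ) ^ (i + 1) → MuBound N (C * n) (u ^ a) := by
  obtain ⟨C, hC⟩ := exists_muBound_pow hu N
  obtain ⟨C', hC'⟩ := exists_muBound_pow hu.inv N
  refine ⟨max C C', fun n hn a ha => ?_⟩
  have ha' : a.natAbs ≤ n ^ (i + 1) := by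
    rw [← Int.natCast_natAbs] at ha
    exact_mod_cast ha
  rcases Int.natAbs_eq a with h | h
  · rw [h, zpow_natCast]
    exact (hC n hn _ ha').mono (Nat.mul_le_mul_right _ (le_max_left _ _))
  · rw [h, zpow_neg, zpow_natCast, ← inv_pow]
    exact (hC' n hn _ ha').mono (Nat.mul_le_mul_right _ (le_max_right _ _))

theorem exists_muBound_prod_zpow {i : ℕ} (N : ℕ) {r : ℕ} (y : Fin r → FreeGroup (Fin d))
    (hy : ∀ s, y s ∈ lcs _ i) :
    ∃ C : ℕ, ∀ n : ℕ, 1 ≤ n → ∀ a : Fin r → ℤ, (∀ s, |a s| ≤ (n : ℤ) ^ (i + 1)) →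
      MuBound N (C * n) (List.ofFn fun s => y s ^ a s).prod⁻¹ := by
  induction r with
  | zero => exact ⟨0, fun n _ a _ => by simpa using MuBound.one⟩
  | succ r ih =>
    obtain ⟨C, hC⟩ := ih (fun s => y s.succ) fun s => hy _
    obtain ⟨C', hC'⟩ := exists_muBound_zpow (InDim.of_mem_lcs (hy 0)) N
    refine ⟨C + C', fun n hn a ha => ?_⟩
    rw [List.ofFn_succ, List.prod_cons, mul_inv_rev, ← zpow_neg, add_mul]
    exact (hC n hn _ fun s => ha _).mul (hC' n hn _ (by rw [abs_neg]; exact ha 0))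

/-- Functionals on `lcs i` grow at most like the `(i+1)`-st power of the quasi-norm. -/
theorem LinOn.exists_abs_le {i : ℕ} {χ : FreeGroup (Fin d) → ℤ} (h : LinOn i χ) {N : ℕ}
    (hN : i + 1 < N) :
    ∃ C : ℕ, ∀ n : ℕ, ∀ u ∈ lcs _ i, MuBound N n u → |χ u| ≤ C * (n : ℤ) ^ (i + 1) := by
  obtain ⟨C, hC⟩ := IsHomog.exists_abs_lin_le (d := d) (i + 1) fun J => dynkin χ J.toList
  refine ⟨C, fun n u hu hb => ?_⟩
  have h1 := hC _ (isHomog_mu (i + 1) u)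
  rw [← h.dynkin_specht_wever hu, abs_mul] at h1
  have h2 : (nrm (mu (i + 1) u) : ℤ) ≤ (n : ℤ) ^ (i + 1) := by exact_mod_cast hb _ hN
  have h3 : |χ u| ≤ |(i : ℤ) + 1| * |χ u| :=
    le_mul_of_one_le_left (abs_nonneg _) (by rw [abs_of_nonneg (by positivity)]; omega)
  calc |χ u| ≤ (nrm (mu (i + 1) u) : ℤ) * C := h3.trans h1
    _ ≤ (n : ℤ) ^ (i + 1) * C := by gcongr
    _ = _ := mul_comm _ _

end QuasiNorm

/-! ### Short words for large powers: distortion in the lower central series -/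

section ShortPowers

variable {d : ℕ}

theorem FreeGroup.norm_pow_le {α : Type*} [DecidableEq α] (x : FreeGroup α) (n : ℕ) :
    (x ^ n).norm ≤ n * x.norm := by
  induction n with
  | zero => simp
  | succ n ih =>
    rw [pow_succ, add_mul, one_mul]
    exact (FreeGroup.norm_mul_le _ _).trans (Nat.add_le_add_right ih _)

theorem FreeGroup.norm_commutator_le {α : Type*} [DecidableEq α] (x y : FreeGroup α) :
    ⁅x, y⁆.norm ≤ 2 * x.norm + 2 * y.norm := by
  rw [commutatorElement_def]
  have h1 := FreeGroup.norm_mul_le (x * y * x⁻¹) y⁻¹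
  have h2 := FreeGroup.norm_mul_le (x * y) x⁻¹
  have h3 := FreeGroup.norm_mul_le x y
  rw [FreeGroup.norm_inv_eq] at h1 h2
  omega

section Quotient

variable {Γ : Type*} [Group Γ] {i : ℕ}

theorem mk_lcs_commute {u : Γ} (hu : u ∈ lcs Γ i) (x : Γ) :
    Commute (QuotientGroup.mk' (lcs Γ (i + 1)) u) (QuotientGroup.mk' (lcs Γ (i + 1)) x) := by
  rw [← commutatorElement_eq_one_iff_commute, ← map_commutatorElement, ← MonoidHom.mem_ker,
    QuotientGroup.ker_mk']
  exact commutator_mem_lcs_succ hu x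

theorem mk_commutator_mul_left {u v : Γ} (hv : v ∈ lcs Γ i) (x : Γ) :
    QuotientGroup.mk' (lcs Γ (i + 2)) ⁅u * v, x⁆ =
      QuotientGroup.mk' (lcs Γ (i + 2)) ⁅u, x⁆ * QuotientGroup.mk' (lcs Γ (i + 2)) ⁅v, x⁆ := by
  have h := mk_lcs_commute (commutator_mem_lcs_succ hv x) u
  rw [commutatorElement_mul_left_eq_conj_mul, map_mul, map_mul, map_mul, ← h.eq, map_inv,
    mul_inv_cancel_right]
  exact (mk_lcs_commute (commutator_mem_lcs_succ hv x) _).eq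

theorem mk_commutator_mul_right {u : Γ} (hu : u ∈ lcs Γ i) (x y : Γ) :
    QuotientGroup.mk' (lcs Γ (i + 2)) ⁅u, x * y⁆ =
      QuotientGroup.mk' (lcs Γ (i + 2)) ⁅u, x⁆ * QuotientGroup.mk' (lcs Γ (i + 2)) ⁅u, y⁆ := by
  have h : Commute (QuotientGroup.mk' (lcs Γ (i + 2)) ⁅u, y⁆) (QuotientGroup.mk' _ x) :=
    mk_lcs_commute (commutator_mem_lcs_succ hu y) x
  rw [commutatorElement_mul_right_eq_mul_conj, map_mul, map_mul, map_mul,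
    mul_assoc _ _ (QuotientGroup.mk' _ ⁅u, y⁆), ← h.eq, ← mul_assoc, map_inv, mul_inv_cancel_right]

theorem mk_commutator_zpow_left {u : Γ} (hu : u ∈ lcs Γ i) (x : Γ) (q : ℤ) :
    QuotientGroup.mk' (lcs Γ (i + 2)) ⁅u ^ q, x⁆ =
      QuotientGroup.mk' (lcs Γ (i + 2)) ⁅u, x⁆ ^ q := by
  induction q using Int.induction_on with
  | zero => rw [zpow_zero, zpow_zero, commutatorElement_one_left, map_one]
  | succ q ih => rw [zpow_add_one, mk_commutator_mul_left hu, ih, zpow_add_one]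
  | pred q ih =>
    have h := mk_commutator_mul_left (u := u ^ (-(q : ℤ) - 1)) hu x
    rw [← zpow_add_one, sub_add_cancel, ih] at h
    rw [zpow_sub_one (G := Γ ⧸ lcs Γ (i + 2)), h, mul_inv_cancel_right]

theorem mk_commutator_pow_right {u : Γ} (hu : u ∈ lcs Γ i) (x : Γ) (n : ℕ) :
    QuotientGroup.mk' (lcs Γ (i + 2)) ⁅u, x ^ n⁆ =
      QuotientGroup.mk' (lcs Γ (i + 2)) ⁅u, x⁆ ^ n := by
  induction n with
  | zero => rw [pow_zero, pow_zero, commutatorElement_one_right, map_one]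
  | succ n ih => rw [pow_succ, mk_commutator_mul_right hu, ih, pow_succ]

theorem mk_commutator_congr_left {u v : Γ} (h : v⁻¹ * u ∈ lcs Γ (i + 1)) (x : Γ) :
    QuotientGroup.mk' (lcs Γ (i + 2)) ⁅u, x⁆ = QuotientGroup.mk' (lcs Γ (i + 2)) ⁅v, x⁆ := by
  have h1 := mk_commutator_mul_left (u := v) (lcs_succ_le i h) x
  have h2 : QuotientGroup.mk' (lcs Γ (i + 2)) ⁅v⁻¹ * u, x⁆ = 1 := by
    rw [← MonoidHom.mem_ker, QuotientGroup.ker_mk']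
    exact commutator_mem_lcs_succ h x
  rwa [mul_inv_cancel_left, h2, mul_one] at h1

end Quotient

/-- In `lcs i`, the powers `u ^ a` with `|a| ≤ n ^ (i + 1)` are represented modulo `lcs (i + 1)` by
words of length `O(n)`. -/
theorem exists_short_zpow {i : ℕ} {u : FreeGroup (Fin d)} (hu : u ∈ lcs _ i) :
    ∃ C : ℕ, ∀ n : ℕ, 1 ≤ n → ∀ a : ℤ, |a| ≤ (n : ℤ) ^ (i + 1) →
      ∃ v ∈ lcs (FreeGroup (Fin d)) i, v.norm ≤ C * n ∧
        QuotientGroup.mk' (lcs (FreeGroup (Fin d)) (i + 1)) v =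
          QuotientGroup.mk' (lcs (FreeGroup (Fin d)) (i + 1)) u ^ a := by
  induction i generalizing u with
  | zero =>
    refine ⟨u.norm, fun n hn a ha => ⟨u ^ a, Subgroup.mem_top _, ?_, map_zpow _ _ _⟩⟩
    rw [zero_add, pow_one] at ha
    have h1 : (u ^ a).norm ≤ a.natAbs * u.norm := by
      rcases Int.natAbs_eq a with h | h
      · conv_lhs => rw [h, zpow_natCast]
        exact FreeGroup.norm_pow_le _ _
      · conv_lhs => rw [h, zpow_neg, zpow_natCast, FreeGroup.norm_inv_eq]
        exact FreeGroup.norm_pow_le _ _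
    rw [← Int.natCast_natAbs] at ha
    rw [mul_comm]
    exact h1.trans (Nat.mul_le_mul_right _ (by exact_mod_cast ha))
  | succ i ih =>
    refine (Subgroup.closure_induction (p := fun u _ => u ∈ lcs (FreeGroup (Fin d)) (i + 1) ∧
      ∃ C : ℕ, ∀ n : ℕ, 1 ≤ n → ∀ a : ℤ, |a| ≤ (n : ℤ) ^ (i + 1 + 1) →
      ∃ v ∈ lcs (FreeGroup (Fin d)) (i + 1), v.norm ≤ C * n ∧
        QuotientGroup.mk' (lcs (FreeGroup (Fin d)) (i + 1 + 1)) v =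
          QuotientGroup.mk' (lcs (FreeGroup (Fin d)) (i + 1 + 1)) u ^ a) ?_ ?_ ?_ ?_ hu).2
    · rintro _ ⟨g, hg, x, -, rfl⟩
      refine ⟨commutator_mem_lcs_succ hg x, ?_⟩
      obtain ⟨C, hC⟩ := ih hg
      refine ⟨2 * C + 4 * x.norm + 2 * g.norm, fun n hn a ha => ?_⟩
      have hn0 : (0 : ℤ) < n := by exact_mod_cast hn
      have hq : |a / n| ≤ (n : ℤ) ^ (i + 1) := by
        rw [abs_le] at ha ⊢
        rw [pow_succ] at ha
        refine ⟨(Int.le_ediv_iff_mul_le hn0).2 (by linarith), ?_⟩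
        calc a / n ≤ ((n : ℤ) ^ (i + 1) * n) / n := Int.ediv_le_ediv hn0 ha.2
          _ = _ := Int.mul_ediv_cancel _ hn0.ne'
      obtain ⟨v, hv, hvn, hva⟩ := hC n hn _ hq
      have hr0 := Int.emod_nonneg a hn0.ne'
      have hrn := Int.emod_lt_of_pos a hn0
      obtain ⟨r, hr⟩ := Int.eq_ofNat_of_zero_le hr0
      have hrn' : r ≤ n := by omega
      -- Divide `a = n * q + r` and let `v` be a short word for `g^q`. By bilinearity the factors
      -- represent `⁅g, x⁆^(q * n)` and `⁅g, x⁆^r`, at the price of O(n) letters.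
      refine ⟨⁅v, x ^ n⁆ * ⁅g, x ^ r⁆,
        mul_mem (commutator_mem_lcs_succ hv _) (commutator_mem_lcs_succ hg _), ?_, ?_⟩
      · have h1 := FreeGroup.norm_mul_le ⁅v, x ^ n⁆ ⁅g, x ^ r⁆
        have h2 := FreeGroup.norm_commutator_le v (x ^ n)
        have h3 := FreeGroup.norm_commutator_le g (x ^ r)
        have h4 := FreeGroup.norm_pow_le x n
        have h5 := (FreeGroup.norm_pow_le x r).trans (Nat.mul_le_mul_right _ hrn')
        have h6 : g.norm ≤ g.norm * n := Nat.le_mul_of_pos_right _ hn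
        calc _ ≤ 2 * (C * n) + 4 * (n * x.norm) + 2 * (g.norm * n) := by omega
          _ = _ := by ring
      · have hcong : v⁻¹ * g ^ (a / n) ∈ lcs (FreeGroup (Fin d)) (i + 1) := by
          rw [← QuotientGroup.eq]
          rw [← map_zpow] at hva
          exact hva
        rw [map_mul, ← mk_commutator_congr_left hcong, mk_commutator_zpow_left hg,
          mk_commutator_pow_right hg, mk_commutator_pow_right hg, ← zpow_natCast, ← zpow_mul,
          ← zpow_natCast, ← zpow_add]
        congr 1
        have h0 := Int.mul_ediv_add_emod a n
        rw [← hr]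
        exact h0
    · exact ⟨one_mem _, 0, fun n _ a _ => ⟨1, one_mem _, by simp, by rw [map_one, one_zpow]⟩⟩
    · rintro x y - - ⟨hx, C, hC⟩ ⟨hy, C', hC'⟩
      refine ⟨mul_mem hx hy, C + C', fun n hn a ha => ?_⟩
      obtain ⟨v, hv, hvn, hva⟩ := hC n hn a ha
      obtain ⟨w, hw, hwn, hwa⟩ := hC' n hn a ha
      refine ⟨v * w, mul_mem hv hw, ?_, ?_⟩
      · rw [add_mul]
        exact (FreeGroup.norm_mul_le _ _).trans (Nat.add_le_add hvn hwn)
      · rw [map_mul, map_mul, (mk_lcs_commute hx y).mul_zpow, hva, hwa]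
    · rintro x - ⟨hx, C, hC⟩
      refine ⟨inv_mem hx, C, fun n hn a ha => ?_⟩
      obtain ⟨v, hv, hvn, hva⟩ := hC n hn (-a) (by rwa [abs_neg])
      exact ⟨v, hv, hvn, by rw [hva, map_inv, inv_zpow, zpow_neg]⟩

theorem exists_short_prod_zpow {i r : ℕ} (y : Fin r → FreeGroup (Fin d))
    (hy : ∀ s, y s ∈ lcs _ i) :
    ∃ C : ℕ, ∀ n : ℕ, 1 ≤ n → ∀ a : Fin r → ℤ, (∀ s, |a s| ≤ (n : ℤ) ^ (i + 1)) →
      ∃ v : FreeGroup (Fin d), v.norm ≤ C * n ∧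
        QuotientGroup.mk' (lcs (FreeGroup (Fin d)) (i + 1)) v =
          QuotientGroup.mk' (lcs (FreeGroup (Fin d)) (i + 1))
            (List.ofFn fun s => y s ^ a s).prod := by
  induction r with
  | zero => exact ⟨0, fun n _ a _ => ⟨1, by simp, by simp⟩⟩
  | succ r ih =>
    obtain ⟨C, hC⟩ := ih (fun s => y s.succ) fun s => hy _
    obtain ⟨C', hC'⟩ := exists_short_zpow (hy 0)
    refine ⟨C' + C, fun n hn a ha => ?_⟩
    obtain ⟨v, hv, hva⟩ := hC n hn (fun s => a s.succ) fun s => ha _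
    obtain ⟨w, -, hw, hwa⟩ := hC' n hn (a 0) (ha 0)
    refine ⟨w * v, ?_, ?_⟩
    · rw [add_mul]
      exact (FreeGroup.norm_mul_le _ _).trans (Nat.add_le_add hw hv)
    · rw [List.ofFn_succ, List.prod_cons, map_mul, map_mul, map_zpow, hva, hwa]

end ShortPowers

/-! ### From bounded quasi-norm back to short words -/

section BallBox

variable {d : ℕ}

/-- Coordinates on a subgroup of `lcs i` modulo `lcs (i + 1)`. -/
theorem exists_lcs_coordinates {i : ℕ} {Q : Subgroup (FreeGroup (Fin d))} (hQ : Q ≤ lcs _ i) :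
    ∃ (r : ℕ) (y : Fin r → FreeGroup (Fin d)) (χ : Fin r → FreeGroup (Fin d) → ℤ)
      (T : Set (FreeGroup (Fin d))), T.Finite ∧ T ⊆ Q ∧ (∀ s, y s ∈ Q) ∧ (∀ s, LinOn i (χ s)) ∧
      ∀ u ∈ Q, ∃ a : Fin r → ℤ, (∀ s, |a s| ≤ |χ s u|) ∧
        ∃ τ ∈ T, ((List.ofFn fun s => y s ^ a s).prod * τ)⁻¹ * u ∈ lcs _ (i + 1) := by
  obtain ⟨S, hS, hSP, hP⟩ := exists_finset_lcs_le (Γ := FreeGroup (Fin d)) inferInstance i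
  obtain ⟨r, y, χ, T, hT, hTQ, hy, hχ, h⟩ := Subgroup.exists_coordinates (lcs_succ_le i)
    inferInstance (Subgroup.commutator_mono le_rfl le_top) hS hSP hP hQ
  exact ⟨r, y, χ, T, hT, hTQ, hy, fun s => ⟨(hχ s).1, (hχ s).2⟩, h⟩

/-- Absorbs the constants into the scale, so that the coordinates meet the hypothesis of the
short-power lemmas at scale `K * n`. -/
theorem LinOn.exists_abs_le_pow {i r : ℕ} {χ : Fin r → FreeGroup (Fin d) → ℤ}
    (h : ∀ s, LinOn i (χ s)) {N : ℕ} (hN : i + 1 < N) :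
    ∃ K : ℕ, 1 ≤ K ∧ ∀ n : ℕ, ∀ u ∈ lcs _ i, MuBound N n u → ∀ s,
      |χ s u| ≤ ((K * n : ℕ) : ℤ) ^ (i + 1) := by
  choose C hC using fun s => (h s).exists_abs_le hN
  refine ⟨∑ s, C s + 1, by omega, fun n u hu hb s => (hC s n u hu hb).trans ?_⟩
  push_cast
  rw [mul_pow]
  have h1 : C s ≤ ∑ s, C s := Finset.single_le_sum (fun _ _ => Nat.zero_le _) (Finset.mem_univ s)
  have h2 : C s ≤ (∑ s, C s + 1) ^ (i + 1) :=
    h1.trans ((Nat.le_succ _).trans (Nat.le_self_pow (by omega) _))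
  have h3 : (C s : ℤ) ≤ (∑ s, (C s : ℤ) + 1) ^ (i + 1) := by exact_mod_cast h2
  gcongr

/-- Elements of quasi-norm at most `n` are represented, modulo a term of the lower central series,
by words of length `O(n)`. -/
theorem exists_short_of_muBound (M k : ℕ) : ∀ i, i + k = M →
    ∃ C : ℕ, ∀ n : ℕ, 1 ≤ n → ∀ u ∈ lcs (FreeGroup (Fin d)) i, MuBound (M + 1) n u →
      ∃ v : FreeGroup (Fin d), v.norm ≤ C * n ∧ v⁻¹ * u ∈ lcs _ M := by
  induction k with
  | zero =>
    rintro i rfl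
    exact ⟨0, fun n _ u hu _ => ⟨1, by simp, by simpa using hu⟩⟩
  | succ k ih =>
    intro i hi
    obtain ⟨C, hC⟩ := ih (i + 1) (by omega)
    obtain ⟨r, y, χ, T, hT, -, hy, hχ, hco⟩ := exists_lcs_coordinates (le_refl (lcs _ i))
    obtain ⟨K, hK, hKχ⟩ := LinOn.exists_abs_le_pow hχ (show i + 1 < M + 1 by omega)
    obtain ⟨C', hC'⟩ := exists_short_prod_zpow y hy
    obtain ⟨B, hB⟩ := (hT.image FreeGroup.norm).bddAbove
    set E := C' * K + B with hE
    refine ⟨E + C * (E + 1), fun n hn u hu hb => ?_⟩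
    obtain ⟨a, ha, τ, hτ, hau⟩ := hco u hu
    obtain ⟨v, hv, hva⟩ := hC' (K * n) (Nat.mul_pos hK hn) a fun s =>
      (ha s).trans (hKχ n u hu hb s)
    have hvτ : (v * τ).norm ≤ E * n := by
      refine (FreeGroup.norm_mul_le _ _).trans ?_
      have : τ.norm ≤ B * n := (hB ⟨τ, hτ, rfl⟩).trans (Nat.le_mul_of_pos_right _ hn)
      calc _ ≤ C' * (K * n) + B * n := Nat.add_le_add hv this
        _ = _ := by rw [hE]; ring
    have hmem : (v * τ)⁻¹ * u ∈ lcs _ (i + 1) := by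
      rw [← QuotientGroup.eq] at hau ⊢
      rw [← hau]
      change QuotientGroup.mk' _ (v * τ) = QuotientGroup.mk' _ (_ * τ)
      rw [map_mul, map_mul, hva]
    -- Removing the short word `v * τ` enlarges the quasi-norm at most by its length, so the
    -- induction continues at a scale linear in `n`.
    have hb' : MuBound (M + 1) ((E + 1) * n) ((v * τ)⁻¹ * u) := by
      refine ((MuBound.norm (v * τ)⁻¹).mul hb).mono ?_
      rw [FreeGroup.norm_inv_eq, add_mul, one_mul]
      omega
    obtain ⟨w, hw, hwu⟩ := hC _ (Nat.mul_pos (Nat.succ_pos _) hn) _ hmem hb'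
    refine ⟨v * τ * w, (FreeGroup.norm_mul_le _ _).trans ?_, ?_⟩
    · calc _ ≤ E * n + C * ((E + 1) * n) := Nat.add_le_add hvτ hw
        _ = _ := by ring
    · rwa [mul_inv_rev, mul_assoc]

end BallBox

/-! ### Area as word length in `R/[R,F]`, and the two growth estimates -/

namespace CentExt

variable {d s : ℕ} (r : Fin s → FreeGroup (Fin d))

/-- The subgroup `[R, F]`. -/
abbrev relCommutator : Subgroup (FreeGroup (Fin d)) :=
  ⁅relSubgroup r, (⊤ : Subgroup (FreeGroup (Fin d)))⁆

instance relSubgroup_normal : (relSubgroup r).Normal := Subgroup.normalClosure_normal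

theorem relCommutator_le : relCommutator r ≤ relSubgroup r := Subgroup.commutator_le_left _ _

variable {r}

theorem IsRelConj.inv {x : FreeGroup (Fin d)} (h : IsRelConj r x) : IsRelConj r x⁻¹ := by
  obtain ⟨g, i, rfl | rfl⟩ := h
  · exact ⟨g, i, Or.inr (by group)⟩
  · exact ⟨g, i, Or.inl (by group)⟩

theorem IsRelConj.mem {x : FreeGroup (Fin d)} (h : IsRelConj r x) : x ∈ relSubgroup r := by
  have hr : ∀ i, r i ∈ relSubgroup r := fun i => Subgroup.subset_normalClosure ⟨i, rfl⟩
  have hc := (relSubgroup_normal r).conj_mem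
  obtain ⟨g, i, rfl | rfl⟩ := h
  · simpa using hc _ (hr i) g⁻¹
  · simpa using hc _ (inv_mem (hr i)) g⁻¹

theorem centArea_le {w : FreeGroup (Fin d)} {m : ℕ} (h : HasCentDecomp r w m) :
    centArea r w ≤ m := Nat.sInf_le h

theorem centArea_mul_le {v w : FreeGroup (Fin d)} (hv : v ∈ relSubgroup r)
    (hw : w ∈ relSubgroup r) : centArea r (v * w) ≤ centArea r v + centArea r w := by
  obtain ⟨L, hL, hLr, hLv⟩ := hasCentDecomp_centArea r hv
  obtain ⟨L', hL', hLr', hLw⟩ := hasCentDecomp_centArea r hw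
  refine centArea_le ⟨L ++ L', by rw [List.length_append, hL, hL'], ?_, ?_⟩
  · intro x hx
    exact (List.mem_append.1 hx).elim (hLr x) (hLr' x)
  · rw [← QuotientGroup.eq] at *
    rw [List.prod_append, QuotientGroup.mk_mul, QuotientGroup.mk_mul, hLv, hLw]

theorem centArea_inv_le {w : FreeGroup (Fin d)} (hw : w ∈ relSubgroup r) :
    centArea r w⁻¹ ≤ centArea r w := by
  obtain ⟨L, hL, hLr, hLw⟩ := hasCentDecomp_centArea r hw
  refine centArea_le ⟨(L.map (·⁻¹)).reverse, by simp [hL], ?_, ?_⟩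
  · intro x hx
    obtain ⟨y, hy, rfl⟩ := List.mem_map.1 (List.mem_reverse.1 hx)
    exact (hLr y hy).inv
  · rw [← QuotientGroup.eq] at *
    rw [← List.prod_inv_reverse, QuotientGroup.mk_inv, QuotientGroup.mk_inv, hLw]

theorem centArea_eq_zero {w : FreeGroup (Fin d)} (hw : w ∈ relCommutator r) : centArea r w = 0 :=
  Nat.le_zero.1 (centArea_le ⟨[], rfl, by simp, by simpa using hw⟩)

theorem centArea_pow_le {w : FreeGroup (Fin d)} (hw : w ∈ relSubgroup r) (n : ℕ) :
    centArea r (w ^ n) ≤ n * centArea r w := by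
  induction n with
  | zero => rw [pow_zero, centArea_eq_zero (one_mem _)]; simp
  | succ n ih =>
    rw [pow_succ, add_mul, one_mul]
    exact (centArea_mul_le (pow_mem hw n) hw).trans (Nat.add_le_add_right ih _)

theorem centArea_zpow_le {w : FreeGroup (Fin d)} (hw : w ∈ relSubgroup r) (a : ℤ) :
    centArea r (w ^ a) ≤ a.natAbs * centArea r w := by
  rcases Int.natAbs_eq a with h | h
  · conv_lhs => rw [h, zpow_natCast]
    exact centArea_pow_le hw _
  · conv_lhs => rw [h, zpow_neg, zpow_natCast]
    exact (centArea_inv_le (pow_mem hw _)).trans (centArea_pow_le hw _)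

theorem ofFn_prod_zpow_mem {Γ : Type*} [Group Γ] {Q : Subgroup Γ} {k : ℕ} {y : Fin k → Γ}
    (hy : ∀ i, y i ∈ Q) (a : Fin k → ℤ) : (List.ofFn fun i => y i ^ a i).prod ∈ Q := by
  refine list_prod_mem fun x hx => ?_
  obtain ⟨i, rfl⟩ := (List.mem_ofFn' _ _).1 hx
  exact zpow_mem (hy i) _

theorem centArea_prod_zpow_le {k : ℕ} {y : Fin k → FreeGroup (Fin d)}
    (hy : ∀ i, y i ∈ relSubgroup r) (a : Fin k → ℤ) {B : ℕ} (ha : ∀ i, (a i).natAbs ≤ B) :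
    centArea r (List.ofFn fun i => y i ^ a i).prod ≤ B * ∑ i, centArea r (y i) := by
  induction k with
  | zero => simp [centArea_eq_zero (one_mem _)]
  | succ k ih =>
    rw [List.ofFn_succ, List.prod_cons, Fin.sum_univ_succ, mul_add]
    refine (centArea_mul_le (zpow_mem (hy 0) _)
      (ofFn_prod_zpow_mem (fun i => hy (Fin.succ i)) fun i => a i.succ)).trans
      (Nat.add_le_add ?_ (ih (fun i => hy _) (fun i => a i.succ) fun i => ha _))
    exact (centArea_zpow_le (hy 0) _).trans (Nat.mul_le_mul_right _ (ha 0))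

theorem centArea_le_centDehn {w : FreeGroup (Fin d)} (hw : w ∈ relSubgroup r) {n : ℕ}
    (hn : w.norm ≤ n) : centArea r w ≤ centDehn r n :=
  (isGreatest_centDehn r n).2 ⟨w, hw, hn, rfl⟩

theorem centDehn_mono : Monotone (centDehn r) := fun m n hmn => by
  obtain ⟨w, hw, hwm, h⟩ := (isGreatest_centDehn r m).1
  rw [← h]
  exact centArea_le_centDehn hw (hwm.trans hmn)

variable (r)

/-- Conjugating a relator changes it only by an element of `[R, F]`. -/
theorem relSubgroup_le_closure_sup :
    relSubgroup r ≤ Subgroup.closure (Set.range r) ⊔ relCommutator r := by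
  refine (Subgroup.closure_le _).2 fun x hx => ?_
  obtain ⟨_, ⟨i, rfl⟩, hc⟩ := Group.mem_conjugatesOfSet_iff.1 hx
  obtain ⟨c, rfl⟩ := isConj_iff.1 hc
  have h1 : c * r i * c⁻¹ = ⁅c, r i⁆ * r i := by simp [commutatorElement_def]
  have h2 : ⁅c, r i⁆ ∈ relCommutator r := by
    rw [← commutatorElement_inv]
    exact inv_mem (Subgroup.commutator_mem_commutator (Subgroup.subset_normalClosure ⟨i, rfl⟩)
      (Subgroup.mem_top c))
  rw [SetLike.mem_coe, h1]
  exact mul_mem ((le_sup_right : relCommutator r ≤ _) h2)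
    ((le_sup_left : Subgroup.closure (Set.range r) ≤ _) (Subgroup.subset_closure ⟨i, rfl⟩))

/-- An integer-valued function that restricts to a homomorphism on `R` vanishing on `[R, F]`. -/
structure RelHom (χ : FreeGroup (Fin d) → ℤ) : Prop where
  map_mul : ∀ u ∈ relSubgroup r, ∀ v ∈ relSubgroup r, χ (u * v) = χ u + χ v
  map_relCommutator : ∀ u ∈ relCommutator r, χ u = 0

/-- Coordinates on a subgroup of `R` modulo `[R, F]`. -/
theorem exists_rel_coordinates {Q : Subgroup (FreeGroup (Fin d))} (hQ : Q ≤ relSubgroup r) :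
    ∃ (k : ℕ) (y : Fin k → FreeGroup (Fin d)) (χ : Fin k → FreeGroup (Fin d) → ℤ)
      (T : Set (FreeGroup (Fin d))), T.Finite ∧ T ⊆ Q ∧ (∀ i, y i ∈ Q) ∧ (∀ i, RelHom r (χ i)) ∧
      ∀ u ∈ Q, ∃ a : Fin k → ℤ, (∀ i, |a i| ≤ |χ i u|) ∧
        ∃ τ ∈ T, ((List.ofFn fun i => y i ^ a i).prod * τ)⁻¹ * u ∈ relCommutator r := by
  obtain ⟨k, y, χ, T, hT, hTQ, hy, hχ, h⟩ := Subgroup.exists_coordinates (relCommutator_le r)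
    inferInstance (Subgroup.commutator_mono le_rfl le_top) (Set.finite_range r)
    (by rintro _ ⟨i, rfl⟩; exact Subgroup.subset_normalClosure ⟨i, rfl⟩)
    (relSubgroup_le_closure_sup r) hQ
  exact ⟨k, y, χ, T, hT, hTQ, hy, fun s => ⟨(hχ s).1, (hχ s).2⟩, h⟩

/-- `w` has infinite order modulo `[R, F]`. -/
def InfOrder (w : FreeGroup (Fin d)) : Prop := ∀ m : ℕ, 0 < m → w ^ m ∉ relCommutator r

variable {r}

namespace RelHom

variable {χ : FreeGroup (Fin d) → ℤ}

theorem map_one (h : RelHom r χ) : χ 1 = 0 := h.map_relCommutator 1 (one_mem _)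

theorem map_inv (h : RelHom r χ) {u : FreeGroup (Fin d)} (hu : u ∈ relSubgroup r) :
    χ u⁻¹ = -χ u := by
  have := h.map_mul u hu u⁻¹ (inv_mem hu)
  rw [mul_inv_cancel, h.map_one] at this
  omega

theorem map_pow (h : RelHom r χ) {u : FreeGroup (Fin d)} (hu : u ∈ relSubgroup r) (n : ℕ) :
    χ (u ^ n) = n * χ u := by
  induction n with
  | zero => simp [h.map_one]
  | succ n ih => rw [pow_succ, h.map_mul _ (pow_mem hu n) _ hu, ih]; push_cast; ring

theorem map_zpow (h : RelHom r χ) {u : FreeGroup (Fin d)} (hu : u ∈ relSubgroup r) (a : ℤ) :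
    χ (u ^ a) = a * χ u := by
  obtain ⟨n, rfl | rfl⟩ := a.eq_nat_or_neg
  · rw [zpow_natCast, h.map_pow hu]
  · rw [zpow_neg, zpow_natCast, h.map_inv (pow_mem hu n), h.map_pow hu, neg_mul]

theorem congr (h : RelHom r χ) {u v : FreeGroup (Fin d)} (hu : u ∈ relSubgroup r)
    (huv : u⁻¹ * v ∈ relCommutator r) : χ v = χ u := by
  have := h.map_mul u hu _ (relCommutator_le r huv)
  rwa [mul_inv_cancel_left, h.map_relCommutator _ huv, add_zero] at this

/-- All conjugates of a relator have the same value under `χ`, so each factor of a decomposition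
contributes boundedly. This is the source of lower bounds on area. -/
theorem exists_abs_le (h : RelHom r χ) :
    ∃ B : ℕ, ∀ w ∈ relSubgroup r, |χ w| ≤ B * (centArea r w : ℤ) := by
  have hr : ∀ i, r i ∈ relSubgroup r := fun i => Subgroup.subset_normalClosure ⟨i, rfl⟩
  refine ⟨∑ i, (χ (r i)).natAbs, fun w hw => ?_⟩
  obtain ⟨L, hL, hLr, hLw⟩ := hasCentDecomp_centArea r hw
  have hmem : ∀ L : List (FreeGroup (Fin d)), (∀ x ∈ L, IsRelConj r x) →
      L.prod ∈ relSubgroup r := fun L hL => list_prod_mem fun x hx => (hL x hx).mem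
  have hconj : ∀ x, IsRelConj r x → |χ x| ≤ (∑ i, (χ (r i)).natAbs : ℕ) := by
    have hc : ∀ u ∈ relSubgroup r, ∀ g, χ (g⁻¹ * u * g) = χ u := by
      intro u hu g
      refine h.congr hu ?_
      rw [show u⁻¹ * (g⁻¹ * u * g) = ⁅u⁻¹, g⁻¹⁆ by simp [commutatorElement_def, mul_assoc]]
      exact Subgroup.commutator_mem_commutator (inv_mem hu) (Subgroup.mem_top _)
    rintro x ⟨g, i, rfl | rfl⟩
    · rw [hc _ (hr i), ← Int.natCast_natAbs]
      exact_mod_cast Finset.single_le_sum (f := fun i => (χ (r i)).natAbs)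
        (fun _ _ => Nat.zero_le _) (Finset.mem_univ i)
    · rw [hc _ (inv_mem (hr i)), h.map_inv (hr i), abs_neg, ← Int.natCast_natAbs]
      exact_mod_cast Finset.single_le_sum (f := fun i => (χ (r i)).natAbs)
        (fun _ _ => Nat.zero_le _) (Finset.mem_univ i)
  rw [h.congr (hmem L hLr) hLw, ← hL]
  clear hL hLw
  induction L with
  | nil => simp [h.map_one]
  | cons x L ih =>
    have hx := hLr x List.mem_cons_self
    have hL' : ∀ x ∈ L, IsRelConj r x := fun y hy => hLr y (List.mem_cons_of_mem _ hy)
    rw [List.prod_cons, h.map_mul _ hx.mem _ (hmem L hL'), List.length_cons, Nat.cast_succ, mul_add,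
      mul_one, add_comm (χ x)]
    exact (abs_add_le _ _).trans (add_le_add (ih hL') (hconj x hx))

end RelHom

/-- If every coordinate functional vanished at `b`, all powers of `b` would lie in the finitely many
cosets of `T`, and two of them would coincide modulo `[R, F]`. -/
theorem InfOrder.exists_relHom {b : FreeGroup (Fin d)} (hb : b ∈ relSubgroup r)
    (h : InfOrder r b) : ∃ χ, RelHom r χ ∧ χ b ≠ 0 := by
  obtain ⟨k, y, χ, T, hT, hTR, hy, hχ, hco⟩ := exists_rel_coordinates r (le_refl (relSubgroup r))
  by_contra! hcon
  have hcos : ∀ m : ℕ, ∃ τ : T, (τ : FreeGroup (Fin d))⁻¹ * b ^ m ∈ relCommutator r := by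
    intro m
    obtain ⟨a, ha, τ, hτ, hm⟩ := hco (b ^ m) (pow_mem hb m)
    have ha0 : ∀ i, a i = 0 := fun i => by
      have := ha i
      rw [(hχ i).map_pow hb, hcon _ (hχ i), mul_zero, abs_zero] at this
      exact abs_nonpos_iff.1 this
    simp only [ha0, zpow_zero, List.ofFn_const, List.prod_replicate, one_pow, one_mul] at hm
    exact ⟨⟨τ, hτ⟩, hm⟩
  choose f hf using hcos
  have := hT.to_subtype
  obtain ⟨m, n, hmn, hfe⟩ := Finite.exists_ne_map_eq_of_infinite f
  wlog hlt : m < n generalizing m n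
  · exact this n m hmn.symm hfe.symm (by omega)
  refine h (n - m) (by omega) ?_
  have h1 := mul_mem (inv_mem (hf m)) (hf n)
  rw [hfe] at h1
  rw [pow_sub _ hlt.le, (Commute.pow_pow_self b n m).inv_right.eq]
  simpa [mul_assoc] using h1

/-- If `R ∩ γ_{i+1}(F)` contains an element of infinite order modulo `[R, F]`, then the centralized
isoperimetric function grows at least like `n ^ (i + 1)`. -/
theorem isBigO_centDehn {M i : ℕ} (hM : lcs _ M ≤ relCommutator r) {b : FreeGroup (Fin d)}
    (hb : b ∈ relSubgroup r) (hbi : b ∈ lcs _ i) (hinf : InfOrder r b) :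
    (fun n : ℕ => (n : ℝ) ^ (i + 1)) =O[atTop] fun n : ℕ => (centDehn r n : ℝ) := by
  obtain ⟨χ, hχ, hχb⟩ := hinf.exists_relHom hb
  obtain ⟨B, hB⟩ := hχ.exists_abs_le
  obtain ⟨C₁, hC₁⟩ := exists_muBound_pow (InDim.of_mem_lcs hbi) (M + 1)
  obtain ⟨C₂, hC₂⟩ := exists_short_of_muBound (d := d) M M 0 (zero_add M)
  set D := C₂ * (C₁ + 1) + 1 with hD
  have key : ∀ n : ℕ, 1 ≤ n → n ^ (i + 1) ≤ B * centDehn r (D * n) := by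
    intro n hn
    -- The power `b^(n^(i+1))` has quasi-norm O(n), hence a representative `v` of length O(n) modulo
    -- `lcs M`. The added 1 keeps the scale positive.
    obtain ⟨v, hv, hvb⟩ := hC₂ ((C₁ + 1) * n) (Nat.mul_pos (Nat.succ_pos _) hn) (b ^ n ^ (i + 1))
      (Subgroup.mem_top _) ((hC₁ n hn _ le_rfl).mono (Nat.mul_le_mul_right _ (Nat.le_succ _)))
    have hvb' := hM hvb
    have hvR : v ∈ relSubgroup r := by
      have := mul_mem (pow_mem hb (n ^ (i + 1))) (inv_mem (relCommutator_le r hvb'))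
      simpa using this
    have hχv := hχ.congr hvR hvb'
    rw [hχ.map_pow hb] at hχv
    have h1 := hB v hvR
    rw [← hχv, abs_mul] at h1
    have h2 : centArea r v ≤ centDehn r (D * n) := centArea_le_centDehn hvR (hv.trans (by
      rw [← mul_assoc]; exact Nat.mul_le_mul_right _ (Nat.le_succ _)))
    have h3 : ((n ^ (i + 1) : ℕ) : ℤ) ≤ |((n ^ (i + 1) : ℕ) : ℤ)| * |χ b| :=
      (le_abs_self _).trans (le_mul_of_one_le_right (abs_nonneg _) (Int.one_le_abs hχb))
    have h4 : n ^ (i + 1) ≤ B * centArea r v := by exact_mod_cast h3.trans h1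
    exact h4.trans (Nat.mul_le_mul_left _ h2)
  -- Monotonicity extends the estimate from multiples of `D` to all `n ≥ D`, where `n ≤ 2 * D * (n /
  -- D)`.
  refine IsBigO.of_bound ((2 * D : ℕ) ^ (i + 1) * B) ?_
  filter_upwards [eventually_ge_atTop D] with n hn
  have hD0 : 0 < D := Nat.succ_pos _
  have hq : 1 ≤ n / D := (Nat.one_le_div_iff hD0).2 hn
  have h1 : n ≤ 2 * D * (n / D) := by
    have h2 := Nat.div_add_mod n D
    have h3 := Nat.mod_lt n hD0
    have h4 : D ≤ D * (n / D) := Nat.le_mul_of_pos_right _ hq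
    calc n ≤ D * (n / D) + D * (n / D) := by omega
      _ = _ := by ring
  have h2 : n ^ (i + 1) ≤ (2 * D) ^ (i + 1) * B * centDehn r n := by
    calc n ^ (i + 1) ≤ (2 * D * (n / D)) ^ (i + 1) := Nat.pow_le_pow_left h1 _
      _ = (2 * D) ^ (i + 1) * (n / D) ^ (i + 1) := mul_pow _ _ _
      _ ≤ (2 * D) ^ (i + 1) * (B * centDehn r n) := Nat.mul_le_mul_left _ ((key _ hq).trans
          (Nat.mul_le_mul_left _ (centDehn_mono (Nat.mul_div_le n D))))
      _ = _ := by ring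
  rw [Real.norm_of_nonneg (by positivity), Real.norm_of_nonneg (by positivity)]
  exact_mod_cast h2

/-- Peeling off level `j ≤ i` leaves a product of powers of fixed elements of `R` with exponents
O(n^(j+1)), hence of area O(n^(i+1)). The induction runs on the quasi-norm instead of the length:
the removed product may be a long word, but its quasi-norm is O(n). -/
theorem exists_centArea_le {i : ℕ}
    (htor : ∀ w ∈ relSubgroup r ⊓ lcs _ (i + 1), ¬ InfOrder r w) (k : ℕ) :
    ∀ j, j + k = i + 1 → ∃ C : ℕ, ∀ n : ℕ, 1 ≤ n → ∀ w ∈ relSubgroup r ⊓ lcs _ j,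
      MuBound (i + 2) n w → centArea r w ≤ C * n ^ (i + 1) := by
  induction k with
  | zero =>
    rintro j rfl
    obtain ⟨k, y, χ, T, hT, hTR, hy, hχ, hco⟩ :=
      exists_rel_coordinates r (inf_le_left : relSubgroup r ⊓ lcs _ (i + 1) ≤ _)
    obtain ⟨B, hB⟩ := (hT.image (centArea r)).bddAbove
    refine ⟨B, fun n hn w hw _ => ?_⟩
    obtain ⟨a, ha, τ, hτ, hm⟩ := hco w hw
    have htw := htor w hw
    simp only [InfOrder, not_forall, not_not] at htw
    obtain ⟨m, hm0, hmw⟩ := htw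
    -- Functionals to `ℤ` vanish on torsion, so only the finitely many representatives in `T` remain
    -- and the area is bounded.
    have ha0 : ∀ i, a i = 0 := fun i => by
      have h1 := (hχ i).map_relCommutator _ hmw
      rw [(hχ i).map_pow hw.1] at h1
      have h2 : χ i w = 0 := by
        rcases mul_eq_zero.1 h1 with h | h
        · omega
        · exact h
      have := ha i
      rw [h2, abs_zero] at this
      exact abs_nonpos_iff.1 this
    simp only [ha0, zpow_zero, List.ofFn_const, List.prod_replicate, one_pow, one_mul] at hm
    have h1 := centArea_mul_le (hTR hτ).1 (relCommutator_le r hm)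
    rw [mul_inv_cancel_left, centArea_eq_zero hm, add_zero] at h1
    exact (h1.trans (hB ⟨τ, hτ, rfl⟩)).trans (Nat.le_mul_of_pos_right _ (Nat.pow_pos hn))
  | succ k ih =>
    intro j hj
    obtain ⟨C, hC⟩ := ih (j + 1) (by omega)
    obtain ⟨l, y, χ, T, hT, hTQ, hy, hχ, hco⟩ :=
      exists_lcs_coordinates (inf_le_right : relSubgroup r ⊓ lcs _ j ≤ _)
    obtain ⟨K, hK, hKχ⟩ := LinOn.exists_abs_le_pow hχ (show j + 1 < i + 2 by omega)
    obtain ⟨C', hC'⟩ := exists_muBound_prod_zpow (i + 2) y fun s => (hy s).2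
    obtain ⟨B, hB⟩ := (hT.image FreeGroup.norm).bddAbove
    obtain ⟨B', hB'⟩ := (hT.image (centArea r)).bddAbove
    set A := ∑ s, centArea r (y s)
    set E := B + C' * K + 1 with hE
    refine ⟨K ^ (j + 1) * A + B' + C * E ^ (i + 1), fun n hn w hw hb => ?_⟩
    obtain ⟨a, ha, τ, hτ, hm⟩ := hco w hw
    have ha' := fun s => (ha s).trans (hKχ n w hw.2 hb s)
    set Y := (List.ofFn fun s => y s ^ a s).prod
    have hYQ : Y ∈ relSubgroup r ⊓ lcs _ j := ofFn_prod_zpow_mem hy a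
    have hτQ := hTQ hτ
    have hmu : MuBound (i + 2) (E * n) ((Y * τ)⁻¹ * w) := by
      rw [mul_inv_rev]
      refine (((MuBound.norm τ⁻¹).mul (hC' _ (Nat.mul_pos hK hn) a ha')).mul hb).mono ?_
      rw [FreeGroup.norm_inv_eq]
      have : τ.norm ≤ B * n := (hB ⟨τ, hτ, rfl⟩).trans (Nat.le_mul_of_pos_right _ hn)
      calc _ ≤ B * n + C' * (K * n) + n := by omega
        _ = _ := by rw [hE]; ring
    have hmem : (Y * τ)⁻¹ * w ∈ relSubgroup r ⊓ lcs _ (j + 1) :=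
      Subgroup.mem_inf.2 ⟨mul_mem (inv_mem (mul_mem hYQ.1 hτQ.1)) hw.1, hm⟩
    have h1 := hC (E * n) (Nat.mul_pos (Nat.succ_pos _) hn) _ hmem hmu
    have h2 := centArea_mul_le (mul_mem hYQ.1 hτQ.1) hmem.1
    rw [mul_inv_cancel_left] at h2
    have h3 := centArea_mul_le hYQ.1 hτQ.1
    have h4 : centArea r Y ≤ (K * n) ^ (j + 1) * A :=
      centArea_prod_zpow_le (fun s => (hy s).1) a fun s => by
        have := ha' s
        rw [← Int.natCast_natAbs] at this
        exact_mod_cast this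
    have h5 : centArea r τ ≤ B' := hB' ⟨τ, hτ, rfl⟩
    have h6 : n ^ (j + 1) ≤ n ^ (i + 1) := Nat.pow_le_pow_right hn (by omega)
    have h7 : 1 ≤ n ^ (i + 1) := Nat.pow_pos hn
    calc centArea r w ≤ (K * n) ^ (j + 1) * A + B' + C * (E * n) ^ (i + 1) := by omega
      _ = K ^ (j + 1) * A * n ^ (j + 1) + B' * 1 + C * E ^ (i + 1) * n ^ (i + 1) := by
          rw [mul_pow, mul_pow]; ring
      _ ≤ K ^ (j + 1) * A * n ^ (i + 1) + B' * n ^ (i + 1) + C * E ^ (i + 1) * n ^ (i + 1) := by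
          gcongr
      _ = _ := by ring

/-- If `R ∩ γ_{i+2}(F)` is torsion modulo `[R, F]`, then the centralized isoperimetric function grows
at most like `n ^ (i + 1)`. -/
theorem centDehn_isBigO {i : ℕ} (htor : ∀ w ∈ relSubgroup r ⊓ lcs _ (i + 1), ¬ InfOrder r w) :
    (fun n : ℕ => (centDehn r n : ℝ)) =O[atTop] fun n : ℕ => (n : ℝ) ^ (i + 1) := by
  obtain ⟨C, hC⟩ := exists_centArea_le htor (i + 1) 0 (zero_add _)
  refine IsBigO.of_bound C ?_
  filter_upwards [eventually_ge_atTop 1] with n hn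
  obtain ⟨w, hw, hwn, h⟩ := (isGreatest_centDehn r n).1
  have := hC n hn w ⟨hw, Subgroup.mem_top _⟩ ((MuBound.norm w).mono hwn)
  rw [h] at this
  rw [Real.norm_of_nonneg (by positivity), Real.norm_of_nonneg (by positivity)]
  exact_mod_cast this

end CentExt

/-! ### Nontrivial commutators detected by the Magnus expansion -/

namespace Tens

open MonoidAlgebra

theorem eq_zero_of_nsmul_eq_zero {d m : ℕ} (hm : m ≠ 0) {p : Tens d} (h : m • p = 0) : p = 0 := by
  ext J
  have h1 : (m • p).coeff J = 0 := by rw [h]; rfl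
  rw [coeff_smul_apply, smul_eq_zero] at h1
  exact h1.resolve_left hm

end Tens

section EngelWords

open Tens

variable {d : ℕ}

theorem InDim.pow {i : ℕ} {u : FreeGroup (Fin d)} (hu : InDim i u) (m : ℕ) : InDim i (u ^ m) := by
  induction m with
  | zero => rw [pow_zero]; exact InDim.one
  | succ m ih => rw [pow_succ]; exact ih.mul hu

theorem InDim.mu_pow {i : ℕ} {u : FreeGroup (Fin d)} (hu : InDim i u) (m : ℕ) :
    mu (i + 1) (u ^ m) = m • mu (i + 1) u := by
  induction m with
  | zero => rw [pow_zero, mu_one, if_neg (by omega), zero_smul]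
  | succ m ih => rw [pow_succ, (hu.pow m).mu_mul_left (by omega) le_rfl, ih, succ_nsmul]

theorem commFold_replicate_mem_lcs (x y : Fin d) (c : ℕ) :
    commFold (FreeGroup.of y) (List.replicate c x) ∈ lcs (FreeGroup (Fin d)) c := by
  induction c with
  | zero => exact Subgroup.mem_top _
  | succ c ih =>
    rw [List.replicate_succ', commFold_append]
    exact commutator_mem_lcs_succ ih _

/-- The left-normed commutators `[⋯[y, x], ⋯, x]` are detected by the Magnus expansion. -/
theorem mu_commFold_replicate_ne_zero {x y : Fin d} (hxy : x ≠ y) (c : ℕ) :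
    mu (c + 1) (commFold (FreeGroup.of y) (List.replicate c x)) ≠ 0 := by
  classical
  -- The coefficient of the word `y x^c` equals 1: since `x ≠ y`, products starting with `x` do not
  -- contribute to it.
  let f : ℕ → FreeMonoid (Fin d) → ℤ := fun c J =>
    if J.toList = y :: List.replicate c x then 1 else 0
  have key : lin (f c) (mu (c + 1) (commFold (FreeGroup.of y) (List.replicate c x))) = 1 := by
    induction c with
    | zero => simp [commFold, mu_of, lin_gen, f]
    | succ c ih =>
      rw [List.replicate_succ', commFold_append,
        (InDim.of_mem_lcs (commFold_replicate_mem_lcs x y c)).mu_commutator, mu_of,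
        if_neg one_ne_zero, if_pos rfl, map_sub, lin_mul_gen, lin_gen_mul]
      have e1 : (fun J => f (c + 1) (J * FreeMonoid.of x)) = f c := by
        funext J
        simp only [f, FreeMonoid.toList_mul, FreeMonoid.toList_of, List.replicate_succ',
          ← List.cons_append, List.append_cancel_right_eq]
      have e2 : (fun J => f (c + 1) (FreeMonoid.of x * J)) = fun _ => 0 := by
        funext J
        simp [f, FreeMonoid.toList_mul, FreeMonoid.toList_of, hxy]
      rw [e1, e2, ih, lin_apply]
      simp
  intro h
  rw [h, map_zero] at key
  exact zero_ne_one key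

theorem FreeGroup.commute_of_subsingleton {α : Type*} [Subsingleton α] (u v : FreeGroup α) :
    Commute u v := by
  have h : ∀ i v, Commute (FreeGroup.of (α := α) i) v := by
    intro i v
    induction v using FreeGroup.induction_on with
    | C1 => exact Commute.one_right _
    | of j => rw [Subsingleton.elim i j]
    | inv_of j ih => exact ih.inv_right
    | mul v w hv hw => exact hv.mul_right hw
  induction u using FreeGroup.induction_on with
  | C1 => exact Commute.one_left _
  | of j => exact h j v
  | inv_of j ih => exact ih.inv_left
  | mul v w hv hw => exact hv.mul_left hw

end EngelWords

/-! ### The torsion case, and passage between `R/[R,F]` and central extensions -/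

namespace CentExt

variable {d s : ℕ} {r : Fin s → FreeGroup (Fin d)}

/-- For nilpotent `F / R`, if `R / [R, F]` is a torsion group, then it is trivial. -/
theorem relSubgroup_le_relCommutator {M : ℕ} (hM : lcs _ M ≤ relSubgroup r)
    (htor : ∀ w ∈ relSubgroup r, ¬ InfOrder r w) : relSubgroup r ≤ relCommutator r := by
  have htor' : ∀ w ∈ relSubgroup r, ∃ m : ℕ, m ≠ 0 ∧ w ^ m ∈ relCommutator r := by
    intro w hw
    have := htor w hw
    simp only [InfOrder, not_forall, not_not] at this
    obtain ⟨m, hm, h⟩ := this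
    exact ⟨m, hm.ne', h⟩
  -- In rank at most 1 the free group is abelian and torsion-free, so `[R, F]` is trivial and so is
  -- `R`.
  by_cases hd : Subsingleton (Fin d)
  · intro w hw
    obtain ⟨m, hm, h⟩ := htor' w hw
    have hbot : relCommutator r = ⊥ := by
      rw [eq_bot_iff, Subgroup.commutator_le]
      intro u _ v _
      rw [Subgroup.mem_bot, commutatorElement_eq_one_iff_commute]
      exact FreeGroup.commute_of_subsingleton u v
    rw [hbot, Subgroup.mem_bot, pow_eq_one_iff_left hm] at h
    rw [h]
    exact one_mem _
  -- If `R` vanishes up to degree `i`, then `[R, F]` vanishes up to degree `i + 1`, and so does `R`,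
  -- because some power of each element lies in `[R, F]` and the ring is torsion-free. But `R`
  -- contains `lcs M`, which has elements with finite leading degree.
  · have hdim : ∀ i, ∀ w ∈ relSubgroup r, InDim i w := by
      intro i
      induction i with
      | zero => exact fun w _ j hj hj' => by omega
      | succ i ih =>
        have hK : ∀ w ∈ relCommutator r, InDim (i + 1) w := by
          intro w hw
          induction hw using Subgroup.closure_induction with
          | mem _ h =>
            obtain ⟨v, hv, x, -, rfl⟩ := h
            exact (ih v hv).commutator x
          | one => exact InDim.one
          | mul _ _ _ _ hx hy => exact hx.mul hy
          | inv _ _ hx => exact hx.inv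
        intro w hw j hj hji
        rcases Nat.lt_succ_iff_lt_or_eq.1 (Nat.lt_succ_of_le hji) with hlt | rfl
        · exact ih w hw j hj (by omega)
        · obtain ⟨m, hm, h⟩ := htor' w hw
          have h1 := hK _ h (i + 1) hj le_rfl
          rw [(ih w hw).mu_pow] at h1
          exact Tens.eq_zero_of_nsmul_eq_zero hm h1
    rw [not_subsingleton_iff_nontrivial] at hd
    obtain ⟨x, y, hxy⟩ := hd
    exact absurd (hdim (M + 1) _ (hM (commFold_replicate_mem_lcs x y M)) _ (by omega) le_rfl)
      (mu_commFold_replicate_ne_zero hxy M)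

theorem centDehn_eq_zero (h : relSubgroup r ≤ relCommutator r) (n : ℕ) : centDehn r n = 0 := by
  obtain ⟨w, hw, -, hwn⟩ := (isGreatest_centDehn r n).1
  rw [← hwn, centArea_eq_zero (h hw)]

section Extension

variable {G : Type*} [Group G] (φ : FreeGroup (Fin d) →* G)

theorem lcs_le_relCommutator (hφ : Function.Surjective φ) (hker : φ.ker = relSubgroup r)
    [Group.IsNilpotent G] :
    ∃ M, lcs _ M ≤ relSubgroup r ∧ lcs _ (M + 1) ≤ relCommutator r := by
  obtain ⟨M, hM⟩ := Subgroup.nilpotent_iff_lowerCentralSeries.1 ‹Group.IsNilpotent G›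
  have h : lcs _ M ≤ relSubgroup r := by
    rw [← hker, ← Subgroup.map_eq_bot_iff, Subgroup.map_lowerCentralSeries,
      Subgroup.map_top_of_surjective φ hφ, hM]
  exact ⟨M, h, Subgroup.commutator_mono h le_rfl⟩

/-- An element of infinite order of the image of `A` in a term `H^(i+2)` of the lower central
series of a central extension comes from `R`. -/
theorem exists_infOrder_of_centralExt {A H : Type*} [Group A] [Group H] (S : GroupExtension A H G)
    (hφ : Function.Surjective φ) (hker : φ.ker = relSubgroup r) (hS : IsCentralExt S) {i : ℕ} {b : H} (hb : b ∈ S.inl.range)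
    (hinf : ¬ IsOfFinOrder b) (hbi : b ∈ lcs H (i + 1)) :
    ∃ w ∈ relSubgroup r, w ∈ lcs _ (i + 1) ∧ InfOrder r w := by
  choose g hg using fun j => S.rightHom_surjective (φ (FreeGroup.of j))
  let ψ : FreeGroup (Fin d) →* H := FreeGroup.lift g
  have hψ : ∀ w, S.rightHom (ψ w) = φ w := by
    have : S.rightHom.comp ψ = φ := FreeGroup.ext_hom _ _ fun j => by simp [ψ, hg]
    exact fun w => DFunLike.congr_fun this w
  have hcen : ∀ x : H, S.rightHom x = 1 → ∀ y, Commute x y := by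
    intro x hx y
    rw [← MonoidHom.mem_ker, ← S.range_inl_eq_ker_rightHom] at hx
    exact ((Subgroup.mem_center_iff.1 (hS hx)) y).symm
  have hK : relCommutator r ≤ ψ.ker := by
    refine Subgroup.commutator_le.2 fun u hu v _ => ?_
    rw [← hker, MonoidHom.mem_ker, ← hψ] at hu
    rw [MonoidHom.mem_ker, map_commutatorElement, (hcen _ hu _).commutator_eq]
  -- Commutators in `H` depend only on the images in `G`, and `F` surjects onto `G`; so entries may
  -- be replaced by images under `ψ`.
  have hred : ∀ u : FreeGroup (Fin d), ∀ y : H, ∃ v, ⁅ψ u, y⁆ = ψ ⁅u, v⁆ := by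
    intro u y
    obtain ⟨v, hv⟩ := hφ (S.rightHom y)
    refine ⟨v, ?_⟩
    have h1 : S.rightHom (y * (ψ v)⁻¹) = 1 := by rw [map_mul, map_inv, hψ, hv, mul_inv_cancel]
    have h2 : y = (y * (ψ v)⁻¹) * ψ v := by simp
    rw [map_commutatorElement, h2, commutatorElement_mul_right_eq_mul_conj,
      (hcen _ h1 (ψ u)).symm.commutator_eq, one_mul, (hcen _ h1 _).eq, mul_inv_cancel_right]
  have hred' : ∀ x y : H, ∃ u, ⁅x, y⁆ = ⁅ψ u, y⁆ := by
    intro x y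
    obtain ⟨u, hu⟩ := hφ (S.rightHom x)
    refine ⟨u, ?_⟩
    have h1 : S.rightHom (x * (ψ u)⁻¹) = 1 := by rw [map_mul, map_inv, hψ, hu, mul_inv_cancel]
    have h2 : x = (x * (ψ u)⁻¹) * ψ u := by simp
    rw [h2, commutatorElement_mul_left_eq_conj_mul, (hcen _ h1 y).commutator_eq, mul_one,
      (hcen _ h1 _).eq, mul_inv_cancel_right]
  -- This starts at the second term of the series because `ψ` need not be surjective onto `H`.
  have hlcs : ∀ i, lcs H (i + 1) ≤ (lcs (FreeGroup (Fin d)) (i + 1)).map ψ := by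
    intro i
    induction i with
    | zero =>
      refine Subgroup.commutator_le.2 fun x _ y _ => ?_
      obtain ⟨u, hu⟩ := hred' x y
      obtain ⟨v, hv⟩ := hred u y
      rw [hu, hv]
      exact ⟨_, commutator_mem_lcs_succ (Subgroup.mem_top u) v, rfl⟩
    | succ i ih =>
      refine Subgroup.commutator_le.2 fun x hx y _ => ?_
      obtain ⟨u, hu, rfl⟩ := ih hx
      obtain ⟨v, hv⟩ := hred u y
      rw [hv]
      exact ⟨_, commutator_mem_lcs_succ hu v, rfl⟩
  obtain ⟨w, hw, rfl⟩ := hlcs i hbi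
  refine ⟨w, ?_, hw, fun m hm hwm => hinf ?_⟩
  · rw [← hker, MonoidHom.mem_ker, ← hψ, ← MonoidHom.mem_ker, ← S.range_inl_eq_ker_rightHom]
    exact hb
  · refine isOfFinOrder_iff_pow_eq_one.2 ⟨m, hm, ?_⟩
    rw [← map_pow]
    exact hK hwm

/-- The kernel of a functional on `R`. -/
def relKer {χ : FreeGroup (Fin d) → ℤ} (hχ : RelHom r χ) : Subgroup (FreeGroup (Fin d)) where
  carrier := {w | w ∈ relSubgroup r ∧ χ w = 0}
  one_mem' := ⟨one_mem _, hχ.map_one⟩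
  mul_mem' := fun ⟨hu, hu'⟩ ⟨hv, hv'⟩ =>
    ⟨mul_mem hu hv, by rw [hχ.map_mul _ hu _ hv, hu', hv', add_zero]⟩
  inv_mem' := fun ⟨hu, hu'⟩ => ⟨inv_mem hu, by rw [hχ.map_inv hu, hu', neg_zero]⟩

theorem relCommutator_le_relKer {χ : FreeGroup (Fin d) → ℤ} (hχ : RelHom r χ) :
    relCommutator r ≤ relKer hχ := fun u hu =>
  ⟨relCommutator_le r hu, hχ.map_relCommutator u hu⟩

instance relKer_normal {χ : FreeGroup (Fin d) → ℤ} (hχ : RelHom r χ) : (relKer hχ).Normal where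
  conj_mem u hu g := by
    rw [show g * u * g⁻¹ = ⁅u, g⁆⁻¹ * u by simp [commutatorElement_def, mul_assoc]]
    exact mul_mem (inv_mem (relCommutator_le_relKer hχ
      (Subgroup.commutator_mem_commutator hu.1 (Subgroup.mem_top g)))) hu

/-- Take `H = F/N` with `N` the kernel on `R` of a functional nonzero at `b`. Centrality follows
from `[R, F] ≤ N`, and `b` keeps infinite order in `H`. -/
theorem exists_centralExt (hφ : Function.Surjective φ) (hker : φ.ker = relSubgroup r) {i : ℕ}
    {b : FreeGroup (Fin d)} (hb : b ∈ relSubgroup r) (hbi : b ∈ lcs _ i) (hinf : InfOrder r b)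
    (htor : ∀ w ∈ relSubgroup r ⊓ lcs _ (i + 1), ¬ InfOrder r w) :
    ∃ (H : Type) (_ : Group H) (S : GroupExtension (Multiplicative ℤ) H G),
      IsCentralExt S ∧ IsDistortionDegree S.inl.range (i + 1) := by
  obtain ⟨χ, hχ, hχb⟩ := hinf.exists_relHom hb
  let N := relKer hχ
  have hNR : N ≤ relSubgroup r := fun u hu => hu.1
  -- The values of `χ` on `R` form a nonzero subgroup of `ℤ`; an element `u` attaining its generator
  -- generates `R/N ≅ ℤ`.
  let A : AddSubgroup ℤ :=
    { carrier := {n | ∃ u ∈ relSubgroup r, χ u = n}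
      zero_mem' := ⟨1, one_mem _, hχ.map_one⟩
      add_mem' := by
        rintro _ _ ⟨u, hu, rfl⟩ ⟨v, hv, rfl⟩
        exact ⟨u * v, mul_mem hu hv, hχ.map_mul u hu v hv⟩
      neg_mem' := by
        rintro _ ⟨u, hu, rfl⟩
        exact ⟨u⁻¹, inv_mem hu, hχ.map_inv hu⟩ }
  obtain ⟨a, ha⟩ := Int.subgroup_cyclic A
  obtain ⟨u, hu, hua⟩ : a ∈ A := ha ▸ AddSubgroup.subset_closure rfl
  have hdvd : ∀ w ∈ relSubgroup r, ∃ n : ℤ, χ w = n * a := by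
    intro w hw
    have : χ w ∈ A := ⟨w, hw, rfl⟩
    rw [ha, AddSubgroup.mem_closure_singleton] at this
    obtain ⟨n, hn⟩ := this
    exact ⟨n, by rw [← hn, smul_eq_mul]⟩
  have ha0 : a ≠ 0 := by
    rintro rfl
    obtain ⟨n, hn⟩ := hdvd b hb
    exact hχb (by rw [hn, mul_zero])
  let π : FreeGroup (Fin d) →* FreeGroup (Fin d) ⧸ N := QuotientGroup.mk' N
  have hπ : ∀ w, π w = 1 ↔ w ∈ relSubgroup r ∧ χ w = 0 := fun w => QuotientGroup.eq_one_iff w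
  have hπs : Function.Surjective π := QuotientGroup.mk'_surjective N
  have hrange : ∀ w, π w ∈ (zpowersHom _ (π u)).range ↔ w ∈ relSubgroup r := by
    intro w
    constructor
    · rintro ⟨n, hn⟩
      rw [zpowersHom_apply, ← map_zpow, eq_comm] at hn
      have h1 : (u ^ n.toAdd)⁻¹ * w ∈ N := by
        rw [← QuotientGroup.eq]
        exact hn.symm
      simpa using mul_mem (zpow_mem hu n.toAdd) (hNR h1)
    · intro hw
      obtain ⟨n, hn⟩ := hdvd w hw
      refine ⟨Multiplicative.ofAdd n, ?_⟩
      rw [zpowersHom_apply, toAdd_ofAdd, ← map_zpow, ← inv_mul_eq_one, ← map_inv, ← map_mul, hπ]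
      refine ⟨mul_mem (inv_mem (zpow_mem hu n)) hw, ?_⟩
      rw [hχ.map_mul _ (inv_mem (zpow_mem hu n)) _ hw, hχ.map_inv (zpow_mem hu n),
        hχ.map_zpow hu, hua, hn]
      ring
  let ρ : FreeGroup (Fin d) ⧸ N →* G := QuotientGroup.lift N φ fun x hx => by
    rw [hker]
    exact hNR hx
  have hρ : ∀ w, ρ (π w) = φ w := fun w => rfl
  let S : GroupExtension (Multiplicative ℤ) (FreeGroup (Fin d) ⧸ N) G :=
    { inl := zpowersHom _ (π u)
      rightHom := ρ
      inl_injective := by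
        rw [injective_iff_map_eq_one]
        intro n hn
        rw [zpowersHom_apply, ← map_zpow, hπ, hχ.map_zpow hu, hua] at hn
        exact (mul_eq_zero.1 hn.2).resolve_right ha0
      range_inl_eq_ker_rightHom := by
        ext x
        obtain ⟨w, rfl⟩ := hπs x
        rw [hrange, MonoidHom.mem_ker, hρ, ← MonoidHom.mem_ker, hker]
      rightHom_surjective := fun g => by
        obtain ⟨w, rfl⟩ := hφ g
        exact ⟨π w, hρ w⟩ }
  have hSrange : ∀ w, π w ∈ S.inl.range ↔ w ∈ relSubgroup r := hrange
  have hlcs : ∀ j, lcs _ j = (lcs (FreeGroup (Fin d)) j).map π := fun j => by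
    rw [Subgroup.map_lowerCentralSeries, Subgroup.map_top_of_surjective π hπs]
  refine ⟨FreeGroup (Fin d) ⧸ N, inferInstance, S, ?_, ⟨by omega, π b, (hSrange b).2 hb, ?_, ?_⟩,
    ?_⟩
  · intro x hx
    obtain ⟨w, rfl⟩ := hπs x
    rw [hSrange] at hx
    refine Subgroup.mem_center_iff.2 fun y => ?_
    obtain ⟨v, rfl⟩ := hπs y
    symm
    rw [← commutatorElement_eq_one_iff_mul_comm, ← map_commutatorElement, hπ]
    exact relCommutator_le_relKer hχ
      (Subgroup.commutator_mem_commutator hx (Subgroup.mem_top v))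
  · rw [isOfFinOrder_iff_pow_eq_one]
    rintro ⟨n, hn, h⟩
    rw [← map_pow, hπ, hχ.map_pow hb, mul_eq_zero] at h
    rcases h.2 with h | h
    · omega
    · exact hχb h
  · rw [Nat.add_sub_cancel]
    exact (hlcs i).ge ⟨b, hbi, rfl⟩
  · rintro j ⟨hj, c, hc, hcinf, hcj⟩
    -- An element in a deeper term would lift to `R ∩ lcs (i + 1)`, which is torsion modulo `[R, F]`
    -- and hence modulo `N`.
    by_contra! hlt
    obtain ⟨w, hw, rfl⟩ := (hlcs _).le hcj
    rw [hSrange] at hc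
    have hw' : w ∈ relSubgroup r ⊓ lcs _ (i + 1) :=
      Subgroup.mem_inf.2 ⟨hc, Subgroup.lowerCentralSeries_antitone _ (by omega) hw⟩
    refine htor w hw' fun m hm hwm => hcinf (isOfFinOrder_iff_pow_eq_one.2 ⟨m, hm, ?_⟩)
    rw [← map_pow, hπ]
    exact relCommutator_le_relKer hχ hwm

end Extension

end CentExt

/-! ### Comparison of exponents and conclusion -/

theorem le_of_natCast_rpow_isBigO {a b : ℝ}
    (h : (fun n : ℕ => (n : ℝ) ^ a) =O[atTop] fun n : ℕ => (n : ℝ) ^ b) : a ≤ b := by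
  by_contra! hlt
  obtain ⟨C, hC⟩ := h.bound
  have h1 := ((tendsto_rpow_atTop (sub_pos.2 hlt)).comp
    tendsto_natCast_atTop_atTop).eventually_gt_atTop C
  obtain ⟨n, hn, hn1, hn0⟩ := (hC.and (h1.and (eventually_gt_atTop 0))).exists
  have hn' : (0 : ℝ) < n := Nat.cast_pos.2 hn0
  rw [Real.norm_of_nonneg (by positivity), Real.norm_of_nonneg (by positivity)] at hn
  rw [Function.comp_apply, Real.rpow_sub hn', lt_div_iff₀ (by positivity)] at hn1
  exact absurd hn1 (not_lt.2 hn)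

theorem proposition3p3 {G : Type*} [Group G] [Group.FG G] [Group.IsNilpotent G]
    {d s : ℕ} (r : Fin s → FreeGroup (Fin d))
    (hpres : Nonempty (PresentedGroup (Set.range r) ≃* G)) :
    (∀ {A H : Type*} [CommGroup A] [Group.FG A] [Group H] (S : GroupExtension A H G),
      CentExt.IsCentralExt S → ∀ k : ℕ, 2 ≤ k → CentExt.IsDistortionDegree S.inl.range k →
        (fun n : ℕ => (n : ℝ) ^ k) =O[atTop] (fun n : ℕ => (CentExt.centDehn r n : ℝ))) ∧
    (∀ κ : ℝ,
      (fun n : ℕ => (CentExt.centDehn r n : ℝ)) =Θ[atTop] (fun n : ℕ => (n : ℝ) ^ κ) →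
        ∃ (H : Type) (_ : Group H) (S : GroupExtension (Multiplicative ℤ) H G) (k : ℕ),
          CentExt.IsCentralExt S ∧ (k : ℝ) = κ ∧ CentExt.IsDistortionDegree S.inl.range k) := by
  obtain ⟨e⟩ := hpres
  let φ : FreeGroup (Fin d) →* G := e.toMonoidHom.comp (PresentedGroup.mk (Set.range r))
  have hφ : Function.Surjective φ := e.surjective.comp (PresentedGroup.mk_surjective _)
  have hker : φ.ker = CentExt.relSubgroup r := by
    ext w
    rw [MonoidHom.mem_ker]
    change e (PresentedGroup.mk _ w) = 1 ↔ _
    rw [map_eq_one_iff e e.injective]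
    exact QuotientGroup.eq_one_iff w
  obtain ⟨M, hM, hM'⟩ := CentExt.lcs_le_relCommutator φ hφ hker
  refine ⟨?_, fun κ hκ => ?_⟩
  · intro A H _ _ _ S hS k hk hdist
    obtain ⟨-, b, hb, hinf, hbk⟩ := hdist.1
    -- Here `2 ≤ k` is essential: only from its second term on is the lower central series of `H`
    -- covered by `F`.
    obtain ⟨i, rfl⟩ : ∃ i, k = i + 1 + 1 := ⟨k - 2, by omega⟩
    obtain ⟨w, hw, hwi, hwinf⟩ :=
      CentExt.exists_infOrder_of_centralExt φ S hφ hker hS hb hinf hbk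
    exact CentExt.isBigO_centDehn hM' hw hwi hwinf
  -- Otherwise `R = [R, F]` and the isoperimetric function is zero, whereas `n^κ` is positive. This
  -- also rules out `κ = 0`.
  have hex : ∃ w ∈ CentExt.relSubgroup r, CentExt.InfOrder r w := by
    by_contra! hcon
    have h0 := CentExt.centDehn_eq_zero (CentExt.relSubgroup_le_relCommutator hM hcon)
    obtain ⟨C, hC⟩ := hκ.isBigO_symm.bound
    obtain ⟨n, hn, hn0⟩ := (hC.and (eventually_gt_atTop 0)).exists
    have hn' : (0 : ℝ) < (n : ℝ) ^ κ := Real.rpow_pos_of_pos (Nat.cast_pos.2 hn0) κ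
    rw [h0, Nat.cast_zero, norm_zero, mul_zero, norm_le_zero_iff] at hn
    exact hn'.ne' hn
  -- A last index with elements of infinite order exists, since `lcs (M + 1)` lies in `[R, F]`.
  obtain ⟨i, ⟨b, hb, hbinf⟩, htor⟩ :
      ∃ i, (∃ w ∈ CentExt.relSubgroup r ⊓ lcs _ i, CentExt.InfOrder r w) ∧
        ∀ w ∈ CentExt.relSubgroup r ⊓ lcs _ (i + 1), ¬ CentExt.InfOrder r w := by
    by_contra! hcon
    have hall : ∀ i, ∃ w ∈ CentExt.relSubgroup r ⊓ lcs _ i, CentExt.InfOrder r w := by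
      intro i
      induction i with
      | zero =>
        obtain ⟨w, hw, h⟩ := hex
        exact ⟨w, Subgroup.mem_inf.2 ⟨hw, Subgroup.mem_top _⟩, h⟩
      | succ i ih => exact hcon i ih
    obtain ⟨w, hw, h⟩ := hall (M + 1)
    exact h 1 one_pos (by rw [pow_one]; exact hM' hw.2)
  have hκi : ((i + 1 : ℕ) : ℝ) = κ := by
    have hlow := (CentExt.isBigO_centDehn hM' hb.1 hb.2 hbinf).trans hκ.isBigO
    have hup := hκ.isBigO_symm.trans (CentExt.centDehn_isBigO htor)
    simp only [← Real.rpow_natCast] at hlow hup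
    exact le_antisymm (le_of_natCast_rpow_isBigO hlow) (le_of_natCast_rpow_isBigO hup)
  obtain ⟨H, hH, S, hS, hdist⟩ := CentExt.exists_centralExt φ hφ hker hb.1 hb.2 hbinf htor
  exact ⟨H, hH, S, i + 1, hS, hκi, hdist⟩
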